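/- Let $M,N,N_r,B\ge 0$ and $K,T\ge 1$ be integers and let $\beta,g_1,\dots,g_K,P_t,\sigma^2>0$; put $\Gamma=P_t/\sigma^2$. A base station (BS) with $M$ antennas receives the pilots of $K$ single-antenna users through a hybrid reflecting and sensing metasurface (HRIS) with $N$ elements and $N_r$ reception chains, during $B$ sub-frames of $T$ slots. The pilot matrix $\mathbf S\in\mathbb C^{K\times T}$ satisfies $\mathbf S\mathbf S^{\rm H}=T\mathbf I_K$ and is sent with power $P_t$. In sub-frame $b$ the HRIS has splitting ratios $\rho_l(b)\in[0,1]$ and phases $\psi_l(b),\phi_{r,l}(b)$. Let $\mathbf\Psi(b)={\rm diag}(\rho_l(b)e^{\jmath\psi_l(b)})_{l=1}^N$, and let $\mathbf\Phi(b)\in\mathbb C^{N_r\times N}$ have the entry $(1-\rho_l(b))e^{\jmath\phi_{r,l}(b)}$ if element $l$ is connected to chain $r$ and $0$ otherwise. The received signals are $$\mathbf y_{\rm RC}(b)=\sqrt{P_t}\,\mathbf\Phi(b)\mathbf G\mathbf S+\mathbf z_{\rm RC}(b),\qquad \mathbf y_{\rm BS}(b)=\sqrt{P_t}\,\mathbf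 H_{\rm BR}\mathbf\Psi(b)\mathbf G\mathbf S+\mathbf z_{\rm BS}(b),$$ where all entries of $\mathbf H_{\rm BR}\in\mathbb C^{M\times N}$, $\mathbf G\in\mathbb C^{N\times K}$, $\mathbf z_{\rm RC}(b)$, $\mathbf z_{\rm BS}(b)$ are independent centred circularly symmetric complex Gaussians, of variance $\beta$ in $\mathbf H_{\rm BR}$, $g_k$ in column $k$ of $\mathbf G$, and $\sigma^2$ in the noises. Let $\tilde{\mathbf y}(b)=\frac{1}{T\sqrt{P_t}}\mathbf y(b)\mathbf S^{\rm H}$ for both receivers, let $\mathbf A$ be the vertical stacking of $\mathbf\Phi(1),\dots,\mathbf\Phi(B)$, $\mathbf R_{\rm G}=(\sum_k g_k)\mathbf I_N$, and $$\mathbf M_{\rm opt}=\mathbf R_{\rm G}\mathbf A^{\rm H}\big(\mathbf A\mathbf R_{\rm G}\mathbf A^{\rm H}+\tfrac{K}{T\Gamma}\mathbf I\big)^{-1},\quad \mathbf\Sigma=\mathbf M_{\rm opt}\mathbf A\mathbf R_{\rm G}^{\rm H},\quad \mathbf R_{\tilde{\mathbf G}}=\big(\mathbf R_{\rm G}^{-1}+\tfrac{T\Gamma}{K}\mathbf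 A^{\rm H}\mathbf A\big)^{-1}.$$ The HRIS forwards to the BS the estimate $\hat{\mathbf G}=\mathbf M_{\rm opt}\tilde{\mathbf y}_{\rm RC}$, where $\tilde{\mathbf y}_{\rm RC}$ is the vertical stacking of the $\tilde{\mathbf y}_{\rm RC}(b)$. Let $\mathbf y_{\rm BS}$ be the stacking of the vectors ${\rm vec}(\tilde{\mathbf y}_{\rm BS}(b))$, and let $$\mathcal E_{\mathbf H_{\rm BR}}=\inf_{\mathbf W}\ \mathbb E\big\|{\rm vec}(\mathbf H_{\rm BR})-\mathbf W(\hat{\mathbf G})\,\mathbf y_{\rm BS}\big\|^2$$ be the mean square error of recovering $\mathbf H_{\rm BR}$ at the BS, the infimum being over all estimators that are linear in $\mathbf y_{\rm BS}$ with a weight matrix $\mathbf W$ that is a measurable function of $\hat{\mathbf G}$. Let $\mathbf D$ be the $BK\times BK$ matrix with the $K\times K$ blocks $$[\mathbf D]_{i,j}=\tfrac{\beta}{K}{\rm Tr}\big(\mathbf\Psi(j)^{\rm H}\mathbf\Psi(i)\mathbf R_{\tilde{\mathbf G}}\big)\mathbf I_K+\delta_{ij}(T\Gamma)^{-1}\mathbf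 I_K,\qquad 1\le i,j\le B.$$ Then $\mathbf D$ and $$\mathbf X=\frac1\beta\mathbf I_{MN}+\Big(K\sum_{j=1}^B\sum_{i=1}^B{\rm Tr}\big([\mathbf D^{-\rm T}]_{i,j}\big)\,\mathbf\Psi(i)\mathbf\Sigma\mathbf\Psi(j)^{\rm H}\Big)^{\rm T}\otimes\mathbf I_M$$ are positive definite, $\mathcal E_{\mathbf H_{\rm BR}}$ is finite, and $$\mathcal E_{\mathbf H_{\rm BR}}\ \ge\ {\rm Tr}\big(\mathbf X^{-1}\big).$$ -/

import Mathlib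

open MeasureTheory ProbabilityTheory Matrix
open scoped Kronecker ENNReal ComplexOrder

/-- The circularly symmetric complex Gaussian law `CN(0, v)`: the real and the imaginary part are
independent real Gaussians of mean `0` and variance `v / 2`. -/
noncomputable def complexGaussian (v : ℝ) : Measure ℂ :=
  ((gaussianReal 0 (v / 2).toNNReal).prod (gaussianReal 0 (v / 2).toNNReal)).map
    Complex.measurableEquivRealProd.symm

/-- The deterministic data of the uplink system: `M` antennas at the BS, `N` hybrid meta-atoms,
`K` single-antenna user terminals, `Nr` reception RF chains at the HRIS, `B` sub-frames of `T` time
slots each. -/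
structure HRISSystem (M N K Nr B T : ℕ) where
  /-- path loss of the BS-HRIS channel -/
  β : ℝ
  /-- path losses of the HRIS-UT channels -/
  g : Fin K → ℝ
  /-- power with which every user terminal transmits its pilots -/
  Pt : ℝ
  /-- common noise power at the HRIS and at the BS -/
  σ2 : ℝ
  /-- pilot matrix; row `k` is the pilot sequence of user `k` -/
  S : Matrix (Fin K) (Fin T) ℂ
  /-- `conn r l`: meta-atom `l` is connected to the reception RF chain `r` -/
  conn : Fin Nr → Fin N → Prop
  /-- power splitting ratios in each sub-frame -/
  ρ : Fin B → Fin N → ℝ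
  /-- reception phases in each sub-frame -/
  φ : Fin B → Fin Nr → Fin N → ℝ
  /-- reflection phases in each sub-frame -/
  ψ : Fin B → Fin N → ℝ
  β_pos : 0 < β
  g_pos : ∀ k, 0 < g k
  Pt_pos : 0 < Pt
  σ2_pos : 0 < σ2
  pilots : S * Sᴴ = (T : ℂ) • (1 : Matrix (Fin K) (Fin K) ℂ)
  ρ_mem : ∀ b l, ρ b l ∈ Set.Icc (0 : ℝ) 1

namespace HRISSystem

variable {M N K Nr B T : ℕ}

/-- The transmit signal-to-noise ratio `Γ = Pt / σ²`. -/
noncomputable def Γ (s : HRISSystem M N K Nr B T) : ℝ := s.Pt / s.σ2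

/-- The reflection matrix `Ψ(b)` of sub-frame `b`. -/
noncomputable def Psi (s : HRISSystem M N K Nr B T) (b : Fin B) : Matrix (Fin N) (Fin N) ℂ :=
  Matrix.diagonal fun l => (s.ρ b l : ℂ) * Complex.exp (Complex.I * (s.ψ b l : ℂ))

open Classical in
/-- The analog combining (reception) matrix of sub-frame `b`. -/
noncomputable def Phi (s : HRISSystem M N K Nr B T) (b : Fin B) : Matrix (Fin Nr) (Fin N) ℂ :=
  Matrix.of fun r l =>
    if s.conn r l then (1 - (s.ρ b l : ℂ)) * Complex.exp (Complex.I * (s.φ b r l : ℂ)) else 0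

/-- The matrices `Φ(1), …, Φ(B)` stacked on top of each other. -/
noncomputable def Arc (s : HRISSystem M N K Nr B T) : Matrix (Fin B × Fin Nr) (Fin N) ℂ :=
  Matrix.of fun p l => s.Phi p.1 p.2 l

/-- `R_G = (∑ₖ gₖ) I_N`. -/
noncomputable def RG (s : HRISSystem M N K Nr B T) : Matrix (Fin N) (Fin N) ℂ :=
  (∑ k, (s.g k : ℂ)) • 1

/-- The linear MMSE weights `M_opt = R_G A^H (A R_G A^H + K (TΓ)⁻¹ I)⁻¹` used by the HRIS. -/
noncomputable def Mopt (s : HRISSystem M N K Nr B T) : Matrix (Fin N) (Fin B × Fin Nr) ℂ :=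
  s.RG * s.Arcᴴ * (s.Arc * s.RG * s.Arcᴴ + ((K : ℂ) * ((T : ℂ) * (s.Γ : ℂ))⁻¹) • 1)⁻¹

/-- `Σ(Φ) = R_G A^H (A R_G A^H + K (TΓ)⁻¹ I)⁻¹ A R_G^H`. -/
noncomputable def Sig (s : HRISSystem M N K Nr B T) : Matrix (Fin N) (Fin N) ℂ :=
  s.RG * s.Arcᴴ * (s.Arc * s.RG * s.Arcᴴ + ((K : ℂ) * ((T : ℂ) * (s.Γ : ℂ))⁻¹) • 1)⁻¹ *
    s.Arc * s.RGᴴ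

/-- `R_{G̃}(Φ) = (R_G⁻¹ + T Γ K⁻¹ A^H A)⁻¹`. -/
noncomputable def RGerr (s : HRISSystem M N K Nr B T) : Matrix (Fin N) (Fin N) ℂ :=
  (s.RG⁻¹ + ((T : ℂ) * (s.Γ : ℂ) * (K : ℂ)⁻¹) • (s.Arcᴴ * s.Arc))⁻¹

/-- The block matrix `D(Ω)`, of `B × B` blocks of size `K × K`: row `(i, k)` is row `k` of the
`i`-th block row. -/
noncomputable def D (s : HRISSystem M N K Nr B T) : Matrix (Fin B × Fin K) (Fin B × Fin K) ℂ :=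
  Matrix.of fun p q =>
    ((((s.β : ℂ) / (K : ℂ)) * ((s.Psi q.1)ᴴ * s.Psi p.1 * s.RGerr).trace) •
        (1 : Matrix (Fin K) (Fin K) ℂ) +
      (if p.1 = q.1 then ((T : ℂ) * (s.Γ : ℂ))⁻¹ • (1 : Matrix (Fin K) (Fin K) ℂ) else 0)) p.2 q.2

/-- The `K × K` block of index `(i, j)` of a `BK × BK` matrix. -/
def block (X : Matrix (Fin B × Fin K) (Fin B × Fin K) ℂ) (i j : Fin B) :
    Matrix (Fin K) (Fin K) ℂ :=
  X.submatrix (fun k => (i, k)) (fun k => (j, k))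

/-- `β⁻¹ I_{MN} + (K ∑ⱼ ∑ᵢ Tr([D⁻ᵀ]_{i,j}) Ψ(i) Σ(Φ) Ψ(j)^H)ᵀ ⊗ I_M`. -/
noncomputable def infoMatrix (s : HRISSystem M N K Nr B T) :
    Matrix (Fin N × Fin M) (Fin N × Fin M) ℂ :=
  (1 / (s.β : ℂ)) • 1 +
    (((K : ℂ) • ∑ j : Fin B, ∑ i : Fin B,
      (block (s.D⁻¹)ᵀ i j).trace • (s.Psi i * s.Sig * (s.Psi j)ᴴ))ᵀ ⊗ₖ
        (1 : Matrix (Fin M) (Fin M) ℂ))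

end HRISSystem

/-- The random quantities of the system: the two channels and the receiver noises. -/
structure HRISRandom (Ω : Type*) (M N K Nr B T : ℕ) where
  /-- BS-HRIS channel -/
  H : Ω → Matrix (Fin M) (Fin N) ℂ
  /-- HRIS-UTs channel; column `k` is the channel of user `k` -/
  G : Ω → Matrix (Fin N) (Fin K) ℂ
  /-- thermal noise at the HRIS in each sub-frame -/
  zRC : Fin B → Ω → Matrix (Fin Nr) (Fin T) ℂ
  /-- thermal noise at the BS in each sub-frame -/
  zBS : Fin B → Ω → Matrix (Fin M) (Fin T) ℂ

namespace HRISRandom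

variable {Ω : Type*} {M N K Nr B T : ℕ}

/-- All scalar random variables of the system, as one family. -/
def entries (x : HRISRandom Ω M N K Nr B T) :
    ((Fin M × Fin N) ⊕ (Fin N × Fin K)) ⊕
      ((Fin B × Fin Nr × Fin T) ⊕ (Fin B × Fin M × Fin T)) → Ω → ℂ
  | .inl (.inl p) => fun ω => x.H ω p.1 p.2
  | .inl (.inr p) => fun ω => x.G ω p.1 p.2
  | .inr (.inl p) => fun ω => x.zRC p.1 ω p.2.1 p.2.2
  | .inr (.inr p) => fun ω => x.zBS p.1 ω p.2.1 p.2.2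

/-- Rayleigh fading and white Gaussian noise: all entries of the channels and of the noises are
independent and centred circularly symmetric complex Gaussian, with variance `β` for the BS-HRIS
channel, `gₖ` for the channel of user `k`, and `σ²` for the noises. -/
structure IsRayleigh [MeasurableSpace Ω] (x : HRISRandom Ω M N K Nr B T)
    (s : HRISSystem M N K Nr B T) (P : Measure Ω) : Prop where
  law_H : ∀ m n, HasLaw (fun ω => x.H ω m n) (complexGaussian s.β) P
  law_G : ∀ n k, HasLaw (fun ω => x.G ω n k) (complexGaussian (s.g k)) P
  law_zRC : ∀ b r t, HasLaw (fun ω => x.zRC b ω r t) (complexGaussian s.σ2) P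
  law_zBS : ∀ b m t, HasLaw (fun ω => x.zBS b ω m t) (complexGaussian s.σ2) P
  indep : iIndepFun x.entries P

/-- The signal received by the HRIS in sub-frame `b`, when the pilots are sent with power `Pt`. -/
noncomputable def yRC (x : HRISRandom Ω M N K Nr B T) (s : HRISSystem M N K Nr B T)
    (b : Fin B) (ω : Ω) : Matrix (Fin Nr) (Fin T) ℂ :=
  s.Phi b * x.G ω * ((Real.sqrt s.Pt : ℂ) • s.S) + x.zRC b ω

/-- The signal received by the BS in sub-frame `b`, when the pilots are sent with power `Pt`. -/
noncomputable def yBS (x : HRISRandom Ω M N K Nr B T) (s : HRISSystem M N K Nr B T)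
    (b : Fin B) (ω : Ω) : Matrix (Fin M) (Fin T) ℂ :=
  x.H ω * s.Psi b * x.G ω * ((Real.sqrt s.Pt : ℂ) • s.S) + x.zBS b ω

/-- Projection of a received signal on the transmitted pilots, scaled so that `A G S √Pt` is
mapped to `A G`. -/
noncomputable def project {n : Type*} (s : HRISSystem M N K Nr B T)
    (y : Matrix n (Fin T) ℂ) : Matrix n (Fin K) ℂ :=
  ((T : ℂ) * (Real.sqrt s.Pt : ℂ))⁻¹ • (y * s.Sᴴ)

/-- The estimate `Ĝ` of `G` that the HRIS computes from its projected observations of all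
sub-frames and forwards to the BS. -/
noncomputable def Ghat (x : HRISRandom Ω M N K Nr B T) (s : HRISSystem M N K Nr B T) (ω : Ω) :
    Matrix (Fin N) (Fin K) ℂ :=
  s.Mopt * Matrix.of fun (p : Fin B × Fin Nr) k => project s (x.yRC s p.1 ω) p.2 k

/-- The stacked projected observation of the BS: the vectors
`vec (ỹ(1)), …, vec (ỹ(B))` on top of each other. -/
noncomputable def obsBS (x : HRISRandom Ω M N K Nr B T) (s : HRISSystem M N K Nr B T) (ω : Ω) :
    Fin B × (Fin K × Fin M) → ℂ :=
  fun p => Matrix.vec (project s (x.yBS s p.1 ω)) p.2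

/-- Weights of a linear estimator of `vec H` from the BS observation, which may depend
(measurably) on the estimate of `G` that the BS is given. -/
def IsWeight
    (W : Matrix (Fin N) (Fin K) ℂ → Matrix (Fin N × Fin M) (Fin B × (Fin K × Fin M)) ℂ) : Prop :=
  ∀ p q, Measurable fun A : Fin N → Fin K → ℂ => W (Matrix.of A) p q

/-- The mean square error `E ‖h - W(Ĝ) y‖²`, where `h = vec H`. -/
noncomputable def mseOf [MeasurableSpace Ω] (x : HRISRandom Ω M N K Nr B T)
    (s : HRISSystem M N K Nr B T) (P : Measure Ω)
    (W : Matrix (Fin N) (Fin K) ℂ → Matrix (Fin N × Fin M) (Fin B × (Fin K × Fin M)) ℂ) : ℝ≥0∞ :=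
  ∫⁻ ω, ∑ p, ‖Matrix.vec (x.H ω) p - (W (x.Ghat s ω) *ᵥ x.obsBS s ω) p‖ₑ ^ 2 ∂P

/-- The error `E_H(Ω)` of recovering the BS-HRIS channel: the minimal mean square error among the
linear estimators from the reflected pilots, given the forwarded estimate `Ĝ`. -/
noncomputable def mseH [MeasurableSpace Ω] (x : HRISRandom Ω M N K Nr B T)
    (s : HRISSystem M N K Nr B T) (P : Measure Ω) : ℝ≥0∞ :=
  ⨅ W ∈ {W : Matrix (Fin N) (Fin K) ℂ → Matrix (Fin N × Fin M) (Fin B × (Fin K × Fin M)) ℂ |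
    IsWeight W}, x.mseOf s P W

end HRISRandom

/-! `Ghat` is a function of the projected pilots `Y` sensed by the metasurface, so it suffices to
bound the error of estimators whose weights may depend on all of `Y`. For each user, `G` is its
linear MMSE estimate from `Y` plus an error. By joint circular Gaussianity uncorrelated means
independent, so `H`, the errors and the BS noise are independent of `Y`. With `Y` frozen, the BS
observes `U h + e`: `U` is built from the estimates, and `e` (the error reflected through `H`, plus
noise) is uncorrelated with `h` and has a covariance `C` that does not depend on `Y`. Completing
squares gives, for all weights and every Hermitian `Z`, the bound `2 tr Z - tr (Z J Z)` with `J =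
β⁻¹ I + Uᴴ C⁻¹ U` (`linear_estimation_mse_bound`). It is affine in `J`, so averaging over `Y` merely
replaces `J` by its mean `β⁻¹ I + (∑ₖ userInfo (gₖ)) ⊗ I` (`integral_information`,
`mse_lower_bound`).

The matrix `X` of the theorem is the same expression with the sum replaced by `K³ userInfo (ḡ)`,
where `ḡ` is the mean of the `gₖ` (`infoMatrix_eq`). Since `gₖ ≤ K ḡ`, Loewner comparisons give
`userInfo (gₖ) ≤ K² userInfo (ḡ)` (`userInfo_le`), hence `E J ≤ X`. The choice `Z = X⁻¹` then yields
`tr X⁻¹`. -/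

/-! ### Moments of the circular complex Gaussian law. -/

theorem complexGaussian_hasLaw_re (v : ℝ) :
    HasLaw Complex.re (gaussianReal 0 (v / 2).toNNReal) (complexGaussian v) where
  aemeasurable := by fun_prop
  map_eq := by
    rw [complexGaussian, Measure.map_map (by fun_prop) (by fun_prop)]
    exact Measure.map_fst_prod.trans (by simp)

theorem complexGaussian_hasLaw_im (v : ℝ) :
    HasLaw Complex.im (gaussianReal 0 (v / 2).toNNReal) (complexGaussian v) where
  aemeasurable := by fun_prop
  map_eq := by
    rw [complexGaussian, Measure.map_map (by fun_prop) (by fun_prop)]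
    exact Measure.map_snd_prod.trans (by simp)

instance isGaussian_complexGaussian (v : ℝ) : IsGaussian (complexGaussian v) := by
  have h : complexGaussian v =
      ((gaussianReal 0 (v / 2).toNNReal).prod (gaussianReal 0 (v / 2).toNNReal)).map
        Complex.equivRealProdCLM.symm := rfl
  rw [h]
  infer_instance

theorem integral_id_complexGaussian (v : ℝ) : ∫ z, z ∂complexGaussian v = 0 := by
  have hi : Integrable (fun z : ℂ => z) (complexGaussian v) := IsGaussian.integrable_id
  apply Complex.ext
  · rw [← RCLike.re_eq_complex_re, ← integral_re hi]
    exact (complexGaussian_hasLaw_re v).integral_eq.trans integral_id_gaussianReal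
  · rw [← RCLike.im_eq_complex_im, ← integral_im hi]
    exact (complexGaussian_hasLaw_im v).integral_eq.trans integral_id_gaussianReal

theorem integral_sq_gaussianReal_zero (v : NNReal) : ∫ x, x ^ 2 ∂gaussianReal 0 v = v := by
  have h := variance_eq_integral (μ := gaussianReal 0 v) (X := fun x => x) (by fun_prop)
  simpa using h.symm

theorem integral_re_sq_complexGaussian {v : ℝ} (hv : 0 ≤ v) :
    ∫ z, z.re ^ 2 ∂complexGaussian v = v / 2 := by
  have h := (complexGaussian_hasLaw_re v).integral_comp (f := fun x => x ^ 2) (by fun_prop)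
  rw [integral_sq_gaussianReal_zero, Real.coe_toNNReal _ (by positivity)] at h
  exact h

theorem integral_im_sq_complexGaussian {v : ℝ} (hv : 0 ≤ v) :
    ∫ z, z.im ^ 2 ∂complexGaussian v = v / 2 := by
  have h := (complexGaussian_hasLaw_im v).integral_comp (f := fun x => x ^ 2) (by fun_prop)
  rw [integral_sq_gaussianReal_zero, Real.coe_toNNReal _ (by positivity)] at h
  exact h

theorem integral_re_mul_im_complexGaussian (v : ℝ) :
    ∫ z, z.re * z.im ∂complexGaussian v = 0 := by
  rw [complexGaussian, integral_map (by fun_prop)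
    (Continuous.aestronglyMeasurable (by fun_prop))]
  refine (integral_prod_mul (fun x : ℝ => x) (fun x : ℝ => x)).trans ?_
  simp

theorem memLp_id_complexGaussian (v : ℝ) : MemLp (fun z : ℂ => z) 2 (complexGaussian v) :=
  IsGaussian.memLp_two_id

theorem integral_mul_self_complexGaussian {v : ℝ} (hv : 0 ≤ v) :
    ∫ z, z * z ∂complexGaussian v = 0 := by
  have hm := memLp_id_complexGaussian v
  have hi : Integrable (fun z : ℂ => z * z) (complexGaussian v) := hm.integrable_mul hm
  have hre : Integrable (fun z : ℂ => z.re ^ 2) (complexGaussian v) := hm.re.integrable_sq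
  have him : Integrable (fun z : ℂ => z.im ^ 2) (complexGaussian v) := hm.im.integrable_sq
  apply Complex.ext
  · rw [← RCLike.re_eq_complex_re, ← integral_re hi]
    have : ∀ z : ℂ, RCLike.re (z * z) = z.re ^ 2 - z.im ^ 2 := fun z => by simp; ring
    simp_rw [this]
    rw [integral_sub hre him, integral_re_sq_complexGaussian hv, integral_im_sq_complexGaussian hv]
    simp
  · rw [← RCLike.im_eq_complex_im, ← integral_im hi]
    have : ∀ z : ℂ, RCLike.im (z * z) = 2 * (z.re * z.im) := fun z => by simp; ring
    simp_rw [this]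
    rw [integral_const_mul, integral_re_mul_im_complexGaussian]
    simp

theorem integral_mul_conj_complexGaussian {v : ℝ} (hv : 0 ≤ v) :
    ∫ z, z * star z ∂complexGaussian v = v := by
  have hm := memLp_id_complexGaussian v
  have hre : Integrable (fun z : ℂ => z.re ^ 2) (complexGaussian v) := hm.re.integrable_sq
  have him : Integrable (fun z : ℂ => z.im ^ 2) (complexGaussian v) := hm.im.integrable_sq
  have : ∀ z : ℂ, z * star z = ((z.re ^ 2 + z.im ^ 2 : ℝ) : ℂ) := fun z => by
    rw [Complex.star_def, Complex.mul_conj, Complex.normSq_apply]; push_cast; ring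
  simp_rw [this]
  rw [integral_complex_ofReal, integral_add hre him, integral_re_sq_complexGaussian hv,
    integral_im_sq_complexGaussian hv]
  norm_num

/-! ### Circular Gaussian spaces: uncorrelated implies independent. -/

/-- A space of random variables that are jointly Gaussian, centred and circularly symmetric. -/
structure IsCircularGaussianSpace {Ω : Type*} [MeasurableSpace Ω] (S : Submodule ℂ (Ω → ℂ))
    (P : Measure Ω) : Prop where
  joint : ∀ (κ : Type) [Finite κ] (X : κ → Ω → ℂ), (∀ i, X i ∈ S) →
    HasGaussianLaw (fun ω i => X i ω) P
  mean : ∀ X ∈ S, ∫ ω, X ω ∂P = 0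
  pseudo : ∀ X ∈ S, ∀ Y ∈ S, ∫ ω, X ω * Y ω ∂P = 0

namespace IsCircularGaussianSpace

variable {Ω : Type*} [MeasurableSpace Ω] {P : Measure Ω} {S : Submodule ℂ (Ω → ℂ)}

theorem hasGaussianLaw (h : IsCircularGaussianSpace S P) {X : Ω → ℂ} (hX : X ∈ S) :
    HasGaussianLaw X P :=
  (h.joint Unit (fun _ => X) fun _ => hX).eval ()

theorem memLp (h : IsCircularGaussianSpace S P) {X : Ω → ℂ} (hX : X ∈ S) {p : ℝ≥0∞}
    (hp : p ≠ ⊤) : MemLp X p P :=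
  (h.hasGaussianLaw hX).memLp hp

theorem memLp_two (h : IsCircularGaussianSpace S P) {X : Ω → ℂ} (hX : X ∈ S) : MemLp X 2 P :=
  h.memLp hX (by simp)

theorem integrable_mul_star {X Y : Ω → ℂ} (hX : MemLp X 2 P) (hY : MemLp Y 2 P) :
    Integrable (fun ω => X ω * star (Y ω)) P :=
  hX.integrable_mul hY.star

theorem integrable_mul (h : IsCircularGaussianSpace S P) {X Y : Ω → ℂ} (hX : X ∈ S)
    (hY : Y ∈ S) : Integrable (fun ω => X ω * Y ω) P :=
  (h.memLp_two hX).integrable_mul (h.memLp_two hY)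

theorem integral_sum_mul_star_sum {κ κ' : Type*} [Fintype κ] [Fintype κ']
    {X : κ → Ω → ℂ} {Y : κ' → Ω → ℂ}
    (hX : ∀ i, MemLp (X i) 2 P) (hY : ∀ j, MemLp (Y j) 2 P) (a : κ → ℂ) (b : κ' → ℂ) :
    ∫ ω, (∑ i, a i * X i ω) * star (∑ j, b j * Y j ω) ∂P =
      ∑ i, ∑ j, a i * star (b j) * ∫ ω, X i ω * star (Y j ω) ∂P := by
  have hint : ∀ i j, Integrable (fun ω => a i * star (b j) * (X i ω * star (Y j ω))) P :=
    fun i j => (integrable_mul_star (hX i) (hY j)).const_mul _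
  have hrw : ∀ ω, (∑ i, a i * X i ω) * star (∑ j, b j * Y j ω) =
      ∑ i, ∑ j, a i * star (b j) * (X i ω * star (Y j ω)) := by
    intro ω
    rw [star_sum, Finset.sum_mul_sum]
    refine Finset.sum_congr rfl fun i _ => Finset.sum_congr rfl fun j _ => ?_
    rw [star_mul']
    ring
  simp_rw [hrw]
  rw [integral_finsetSum _ fun i _ => integrable_finsetSum _ fun j _ => hint i j]
  refine Finset.sum_congr rfl fun i _ => ?_
  rw [integral_finsetSum _ fun j _ => hint i j]
  exact Finset.sum_congr rfl fun j _ => integral_const_mul _ _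

/-- On `ℂ`, a real functional `L` is `z ↦ Re ((L 1 - i L i) z)`. This reduces covariances of real
functionals to complex second moments. -/
theorem strongDual_pi_apply {κ : Type*} [Fintype κ] [DecidableEq κ]
    (L : StrongDual ℝ (κ → ℂ)) (x : κ → ℂ) :
    L x = (∑ i, ((L (Pi.single i 1) : ℂ) - Complex.I * (L (Pi.single i Complex.I) : ℂ)) *
      x i).re := by
  have hx : x = ∑ i, ((x i).re • (Pi.single i (1 : ℂ) : κ → ℂ) +
      (x i).im • (Pi.single i Complex.I : κ → ℂ)) := by
    funext j
    rw [Finset.sum_apply, Finset.sum_eq_single j]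
    · simp [Complex.re_add_im]
    · intro i _ hij
      simp [hij.symm]
    · simp
  conv_lhs => rw [hx]
  rw [map_sum, Complex.re_sum]
  refine Finset.sum_congr rfl fun i _ => ?_
  rw [map_add, map_smul, map_smul]
  simp
  ring

/-- For jointly Gaussian vectors it is enough that real functionals have zero covariance. These are
real parts of elements `X'`, `Y'` of `S`, and `Re X' Re Y' = ½ Re (X' conj Y' + X' Y')`: the first
term has mean zero by `hXY`, the second by circularity. -/
theorem indepFun (h : IsCircularGaussianSpace S P) {κ κ' : Type} [Fintype κ] [Fintype κ']
    {X : κ → Ω → ℂ} {Y : κ' → Ω → ℂ} (hX : ∀ i, X i ∈ S) (hY : ∀ j, Y j ∈ S)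
    (hXY : ∀ i j, ∫ ω, X i ω * star (Y j ω) ∂P = 0) :
    IndepFun (fun ω i => X i ω) (fun ω j => Y j ω) P := by
  classical
  have hjoint : HasGaussianLaw (fun ω => ((fun i => X i ω), (fun j => Y j ω))) P := by
    have h1 := h.joint (κ ⊕ κ') (Sum.elim X Y) (by rintro (i | j) <;> simp [hX, hY])
    exact h1.map_fun (((ContinuousLinearMap.pi fun i =>
      ContinuousLinearMap.proj (R := ℝ) (φ := fun _ : κ ⊕ κ' => ℂ) (Sum.inl i))).prod
      (ContinuousLinearMap.pi fun j =>
        ContinuousLinearMap.proj (R := ℝ) (φ := fun _ : κ ⊕ κ' => ℂ) (Sum.inr j)))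
  have := hjoint.isProbabilityMeasure
  refine hjoint.indepFun_of_covariance_strongDual fun L₁ L₂ => ?_
  set c : κ → ℂ := fun i => (L₁ (Pi.single i 1) : ℂ) - Complex.I * (L₁ (Pi.single i Complex.I) : ℂ)
  set d : κ' → ℂ := fun i =>
    (L₂ (Pi.single i 1) : ℂ) - Complex.I * (L₂ (Pi.single i Complex.I) : ℂ)
  set X' : Ω → ℂ := fun ω => ∑ i, c i * X i ω
  set Y' : Ω → ℂ := fun ω => ∑ j, d j * Y j ω
  have hX' : X' ∈ S := by
    have : X' = ∑ i, c i • X i := by ext ω; simp [X']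
    rw [this]
    exact S.sum_mem fun i _ => S.smul_mem _ (hX i)
  have hY' : Y' ∈ S := by
    have : Y' = ∑ j, d j • Y j := by ext ω; simp [Y']
    rw [this]
    exact S.sum_mem fun i _ => S.smul_mem _ (hY i)
  have e1 : L₁ ∘ (fun ω i => X i ω) = fun ω => (X' ω).re :=
    funext fun ω => strongDual_pi_apply L₁ _
  have e2 : L₂ ∘ (fun ω i => Y i ω) = fun ω => (Y' ω).re :=
    funext fun ω => strongDual_pi_apply L₂ _
  have mX := h.memLp_two hX'
  have mY := h.memLp_two hY'
  rw [e1, e2]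
  refine (covariance_eq_sub mX.re mY.re).trans ?_
  have z1 : ∫ ω, (X' ω).re ∂P = 0 := by
    have := integral_re (mX.integrable (by norm_num))
    rw [h.mean X' hX'] at this
    simpa using this
  have z2 : ∫ ω, X' ω * star (Y' ω) ∂P = 0 := by
    rw [integral_sum_mul_star_sum (fun i => h.memLp_two (hX i)) fun j => h.memLp_two (hY j)]
    simp only [hXY, mul_zero, Finset.sum_const_zero]
  have z3 : ∫ ω, (X' ω).re * (Y' ω).re ∂P = 0 := by
    have hi : Integrable (fun ω => X' ω * star (Y' ω) + X' ω * Y' ω) P :=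
      (integrable_mul_star mX mY).add (h.integrable_mul hX' hY')
    have h4 : ∀ ω, (X' ω).re * (Y' ω).re =
        (1 / 2) * RCLike.re (X' ω * star (Y' ω) + X' ω * Y' ω) := fun ω => by
      simp; ring
    simp_rw [h4]
    rw [integral_const_mul, integral_re hi, integral_add (integrable_mul_star mX mY)
      (h.integrable_mul hX' hY'), z2, h.pseudo X' hX' Y' hY']
    simp
  change ∫ ω, (X' ω).re * (Y' ω).re ∂P - (∫ ω, (X' ω).re ∂P) * _ = 0
  rw [z1, z3]
  simp

end IsCircularGaussianSpace

/-! ### The span of an independent family of complex Gaussians. -/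

section IndependentFamily

variable {Ω : Type*} [MeasurableSpace Ω] {P : Measure Ω} {ι : Type*} {ξ : ι → Ω → ℂ}
  {v : ι → ℝ}

theorem integral_mul_star_of_iIndepFun (hv : ∀ i, 0 ≤ v i)
    (hlaw : ∀ i, HasLaw (ξ i) (complexGaussian (v i)) P) (hind : iIndepFun ξ P)
    [DecidableEq ι] (i j : ι) :
    ∫ ω, ξ i ω * star (ξ j ω) ∂P = if i = j then (v i : ℂ) else 0 := by
  split_ifs with hij
  · subst hij
    rw [← integral_mul_conj_complexGaussian (hv i)]
    exact (hlaw i).integral_comp (f := fun z => z * star z)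
      (Continuous.aestronglyMeasurable (by fun_prop))
  · have h1 := (hind.indepFun hij).comp (φ := fun z => z) (ψ := fun z => star z)
      measurable_id (by fun_prop)
    have h2 := h1.integral_mul_eq_mul_integral (hlaw i).aemeasurable.aestronglyMeasurable
      ((continuous_star.measurable.comp_aemeasurable (hlaw j).aemeasurable).aestronglyMeasurable)
    refine h2.trans ?_
    have : ∫ ω, ξ i ω ∂P = 0 := by
      rw [(hlaw i).integral_eq, integral_id_complexGaussian]
    simp [this]

theorem integral_mul_of_iIndepFun (hv : ∀ i, 0 ≤ v i)
    (hlaw : ∀ i, HasLaw (ξ i) (complexGaussian (v i)) P) (hind : iIndepFun ξ P) (i j : ι) :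
    ∫ ω, ξ i ω * ξ j ω ∂P = 0 := by
  by_cases hij : i = j
  · subst hij
    rw [← integral_mul_self_complexGaussian (hv i)]
    exact (hlaw i).integral_comp (f := fun z => z * z)
      (Continuous.aestronglyMeasurable (by fun_prop))
  · refine ((hind.indepFun hij).integral_mul_eq_mul_integral
      (hlaw i).aemeasurable.aestronglyMeasurable
      (hlaw j).aemeasurable.aestronglyMeasurable).trans ?_
    rw [(hlaw i).integral_eq, integral_id_complexGaussian, zero_mul]

theorem isCircularGaussianSpace_span [Fintype ι] (hv : ∀ i, 0 ≤ v i)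
    (hlaw : ∀ i, HasLaw (ξ i) (complexGaussian (v i)) P) (hind : iIndepFun ξ P) :
    IsCircularGaussianSpace (Submodule.span ℂ (Set.range ξ)) P := by
  have := hind.isProbabilityMeasure
  have hg : ∀ i, HasGaussianLaw (ξ i) P := fun i => (hlaw i).hasGaussianLaw
  have hm : ∀ i, MemLp (ξ i) 2 P := fun i => (hg i).memLp_two
  refine ⟨fun κ _ X hX => ?_, fun X hX => ?_, fun X hX Y hY => ?_⟩
  · have hX' := fun i => (Submodule.mem_span_range_iff_exists_fun ℂ).1 (hX i)
    choose c hc using hX'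
    have hξ := hind.hasGaussianLaw hg
    have := Fintype.ofFinite κ
    have h2 := hξ.map_fun (ContinuousLinearMap.pi fun i : κ => ∑ j,
      (ContinuousLinearMap.mul ℝ ℂ (c i j)).comp
        (ContinuousLinearMap.proj (R := ℝ) (φ := fun _ : ι => ℂ) j))
    have he : (fun ω i => X i ω) = fun ω => (ContinuousLinearMap.pi fun i : κ => ∑ j,
        (ContinuousLinearMap.mul ℝ ℂ (c i j)).comp
          (ContinuousLinearMap.proj (R := ℝ) (φ := fun _ : ι => ℂ) j)) fun x => ξ x ω := by
      funext ω i
      rw [← hc i]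
      simp
    rw [he]
    exact h2
  · obtain ⟨c, rfl⟩ := (Submodule.mem_span_range_iff_exists_fun ℂ).1 hX
    simp only [Finset.sum_apply, Pi.smul_apply, smul_eq_mul]
    rw [integral_finsetSum _ fun i _ => ((hm i).integrable (by norm_num)).const_mul _]
    refine Finset.sum_eq_zero fun i _ => ?_
    rw [integral_const_mul, (hlaw i).integral_eq, integral_id_complexGaussian, mul_zero]
  · obtain ⟨c, rfl⟩ := (Submodule.mem_span_range_iff_exists_fun ℂ).1 hX
    obtain ⟨d, rfl⟩ := (Submodule.mem_span_range_iff_exists_fun ℂ).1 hY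
    simp only [Finset.sum_apply, Pi.smul_apply, smul_eq_mul, Finset.sum_mul_sum]
    have hint : ∀ i j, Integrable (fun ω => c i * ξ i ω * (d j * ξ j ω)) P := fun i j =>
      ((hm i).const_mul _).integrable_mul ((hm j).const_mul _)
    rw [integral_finsetSum _ fun i _ => integrable_finsetSum _ fun j _ => hint i j]
    refine Finset.sum_eq_zero fun i _ => ?_
    rw [integral_finsetSum _ fun j _ => hint i j]
    refine Finset.sum_eq_zero fun j _ => ?_
    have : ∀ ω, c i * ξ i ω * (d j * ξ j ω) = c i * d j * (ξ i ω * ξ j ω) := fun ω => by ring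
    simp_rw [this]
    rw [integral_const_mul, integral_mul_of_iIndepFun hv hlaw hind, mul_zero]

end IndependentFamily

/-! ### The Loewner order: congruence, inversion, Hadamard products. -/

section Loewner

open scoped MatrixOrder

variable {m n p : Type*} [Fintype m] [Fintype n] [Fintype p]
  [DecidableEq m] [DecidableEq n] [DecidableEq p]

omit [Fintype n] [DecidableEq n] in
theorem Matrix.smul_le_smul_of_coe_nonneg {X Y : Matrix n n ℂ} (h : X ≤ Y) {c : ℝ} (hc : 0 ≤ c) :
    (c : ℂ) • X ≤ (c : ℂ) • Y := by
  rw [Matrix.le_iff, ← smul_sub]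
  exact PosSemidef.smul h (by exact_mod_cast hc)

omit [Fintype n] [DecidableEq n] in
theorem Matrix.coe_smul_le_coe_smul {X : Matrix n n ℂ} (h : 0 ≤ X) {a b : ℝ} (hab : a ≤ b) :
    (a : ℂ) • X ≤ (b : ℂ) • X := by
  rw [Matrix.le_iff, ← sub_smul]
  refine PosSemidef.smul (nonneg_iff_posSemidef.1 h) ?_
  rw [sub_nonneg]
  exact_mod_cast hab

omit [DecidableEq m] [DecidableEq n] in
theorem Matrix.conj_le_conj {X Y : Matrix n n ℂ} (h : X ≤ Y) (V : Matrix m n ℂ) :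
    V * X * Vᴴ ≤ V * Y * Vᴴ := by
  rw [Matrix.le_iff, ← Matrix.sub_mul, ← Matrix.mul_sub]
  exact PosSemidef.mul_mul_conjTranspose_same h V

omit [DecidableEq m] [DecidableEq n] in
theorem Matrix.conjTranspose_conj_le_conj {X Y : Matrix n n ℂ} (h : X ≤ Y) (V : Matrix n m ℂ) :
    Vᴴ * X * V ≤ Vᴴ * Y * V := by
  simpa using conj_le_conj h Vᴴ

theorem Matrix.PosDef.isUnit_det {X : Matrix n n ℂ} (h : X.PosDef) : IsUnit X.det :=
  (Matrix.isUnit_iff_isUnit_det X).1 h.isUnit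

/-- With `Δ = X⁻¹ - Y⁻¹` one has `Δ = Δ X Δ + Y⁻¹ (Y - X) Y⁻¹`, a sum of two positive semidefinite
terms. -/
theorem Matrix.PosDef.inv_le_inv {X Y : Matrix n n ℂ} (hX : X.PosDef) (hY : Y.PosDef)
    (h : X ≤ Y) : Y⁻¹ ≤ X⁻¹ := by
  have hXi : (X⁻¹)ᴴ = X⁻¹ := hX.isHermitian.inv
  have hYi : (Y⁻¹)ᴴ = Y⁻¹ := hY.isHermitian.inv
  have e : X⁻¹ - Y⁻¹ = (X⁻¹ - Y⁻¹) * X * (X⁻¹ - Y⁻¹)ᴴ + Y⁻¹ * (Y - X) * (Y⁻¹)ᴴ := by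
    rw [conjTranspose_sub, hXi, hYi]
    have h1 : X⁻¹ * X = 1 := nonsing_inv_mul X hX.isUnit_det
    have h2 : X * X⁻¹ = 1 := mul_nonsing_inv X hX.isUnit_det
    have h3 : Y⁻¹ * Y = 1 := nonsing_inv_mul Y hY.isUnit_det
    simp only [Matrix.sub_mul, Matrix.mul_sub, Matrix.mul_assoc, h2, h1, h3, Matrix.mul_one]
    simp only [← Matrix.mul_assoc, Matrix.one_mul]
    abel
  rw [Matrix.le_iff, e]
  exact (hX.posSemidef.mul_mul_conjTranspose_same _).add
    (PosSemidef.mul_mul_conjTranspose_same h _)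

theorem Matrix.inv_smul_of_ne_zero {X : Matrix n n ℂ} (hX : IsUnit X.det) {c : ℂ} (hc : c ≠ 0) :
    (c • X)⁻¹ = c⁻¹ • X⁻¹ :=
  inv_eq_left_inv (by simp [smul_smul, hc, nonsing_inv_mul X hX])

theorem Matrix.PosDef.inv_le_smul_inv {X Y : Matrix n n ℂ} (hX : X.PosDef) (hY : Y.PosDef)
    {c : ℝ} (hc : 0 < c) (h : X ≤ (c : ℂ) • Y) : Y⁻¹ ≤ (c : ℂ) • X⁻¹ := by
  have hc' : (c : ℂ) ≠ 0 := by exact_mod_cast hc.ne'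
  have h1 := hX.inv_le_inv (hY.smul (by exact_mod_cast hc : (0 : ℂ) < c)) h
  rw [inv_smul_of_ne_zero hY.isUnit_det hc'] at h1
  have h2 := smul_le_smul_of_coe_nonneg h1 hc.le
  rwa [smul_smul, mul_inv_cancel₀ hc', one_smul] at h2

omit [Fintype n] [DecidableEq n] in
-- Schur's product theorem, applied to each term of a telescoped difference.
theorem Matrix.hadamard_le_hadamard {X X' Y Y' : Matrix n n ℂ} (hX : X ≤ X') (hY : Y ≤ Y')
    (h0 : 0 ≤ X) (h0' : 0 ≤ Y') : X ⊙ Y ≤ X' ⊙ Y' := by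
  have e : X' ⊙ Y' - X ⊙ Y = (X' - X) ⊙ Y' + X ⊙ (Y' - Y) := by
    ext i j
    simp only [hadamard_apply, sub_apply, add_apply]
    ring
  rw [Matrix.le_iff, e]
  exact (PosSemidef.hadamard hX (nonneg_iff_posSemidef.1 h0')).add
    (PosSemidef.hadamard (nonneg_iff_posSemidef.1 h0) hY)

omit [Fintype n] [DecidableEq n] in
theorem Matrix.transpose_le_transpose {X Y : Matrix n n ℂ} (h : X ≤ Y) : Xᵀ ≤ Yᵀ := by
  rw [Matrix.le_iff, ← transpose_sub]
  exact PosSemidef.transpose h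

omit [DecidableEq n] in
theorem Matrix.re_trace_le_re_trace {X Y : Matrix n n ℂ} (h : X ≤ Y) :
    X.trace.re ≤ Y.trace.re := by
  have h1 : 0 ≤ (Y - X).trace := PosSemidef.trace_nonneg h
  rw [trace_sub] at h1
  have := (Complex.le_def.1 h1).1
  simpa using this

end Loewner

/-! ### Covariance matrices of linear minimum mean square error estimation -/

section LMMSE

open scoped MatrixOrder

variable {m n p : Type*} [Fintype m] [Fintype n] [Fintype p]
  [DecidableEq m] [DecidableEq n] [DecidableEq p]

/-- The covariance of `A x + z` when `x` and `z` are white of variances `g` and `ν`. -/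
noncomputable def obsCov (A : Matrix m n ℂ) (ν g : ℝ) : Matrix m m ℂ :=
  (g : ℂ) • (A * Aᴴ) + (ν : ℂ) • 1

/-- The weights of the linear MMSE estimator of `x` from `A x + z`. -/
noncomputable def lmmseWeight (A : Matrix m n ℂ) (ν g : ℝ) : Matrix n m ℂ :=
  (g : ℂ) • (Aᴴ * (obsCov A ν g)⁻¹)

/-- The covariance of the linear MMSE estimator of `x` from `A x + z`. -/
noncomputable def estCov (A : Matrix m n ℂ) (ν g : ℝ) : Matrix n n ℂ :=
  ((g : ℂ) ^ 2) • (Aᴴ * (obsCov A ν g)⁻¹ * A)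

/-- The covariance of the error of the linear MMSE estimator of `x` from `A x + z`. -/
noncomputable def errCov (A : Matrix m n ℂ) (ν g : ℝ) : Matrix n n ℂ :=
  (g : ℂ) • 1 - estCov A ν g

variable {A : Matrix m n ℂ} {ν g : ℝ}

omit [DecidableEq n] in
theorem posDef_obsCov (hν : 0 < ν) (hg : 0 ≤ g) : (obsCov A ν g).PosDef :=
  PosDef.posSemidef_add
    ((posSemidef_self_mul_conjTranspose A).smul (by exact_mod_cast hg : (0 : ℂ) ≤ g))
    (PosDef.one.smul (by exact_mod_cast hν : (0 : ℂ) < ν))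

omit [DecidableEq n] in
theorem lmmseWeight_mul_obsCov (hν : 0 < ν) (hg : 0 ≤ g) :
    lmmseWeight A ν g * obsCov A ν g = (g : ℂ) • Aᴴ := by
  rw [lmmseWeight, Matrix.smul_mul, Matrix.mul_assoc,
    nonsing_inv_mul _ (posDef_obsCov hν hg).isUnit_det, Matrix.mul_one]

omit [DecidableEq n] in
theorem lmmseWeight_mul (A : Matrix m n ℂ) (ν g : ℝ) :
    (g : ℂ) • (lmmseWeight A ν g * A) = estCov A ν g := by
  rw [lmmseWeight, estCov, Matrix.smul_mul, smul_smul, sq]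

omit [DecidableEq n] in
theorem posSemidef_estCov (hν : 0 < ν) (hg : 0 ≤ g) : (estCov A ν g).PosSemidef :=
  ((posDef_obsCov hν hg).inv.posSemidef.conjTranspose_mul_mul_same A).smul
    (by positivity : (0 : ℂ) ≤ (g : ℂ) ^ 2)

/-- The inverse of the error covariance. -/
noncomputable def errPrecision (A : Matrix m n ℂ) (ν g : ℝ) : Matrix n n ℂ :=
  (g : ℂ)⁻¹ • 1 + (ν : ℂ)⁻¹ • (Aᴴ * A)

omit [DecidableEq m] in
theorem posDef_errPrecision (hν : 0 < ν) (hg : 0 < g) : (errPrecision A ν g).PosDef :=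
  PosDef.add_posSemidef
    (PosDef.one.smul (by exact_mod_cast inv_pos.2 hg : (0 : ℂ) < (g : ℂ)⁻¹))
    ((posSemidef_conjTranspose_mul_self A).smul
      (by exact_mod_cast (inv_pos.2 hν).le : (0 : ℂ) ≤ (ν : ℂ)⁻¹))

/-- The matrix inversion lemma. In precision form the dependence on `g` sits in a single scalar
term, which is what `errCov_le` compares. -/
theorem errCov_eq_inv (hν : 0 < ν) (hg : 0 < g) : errCov A ν g = (errPrecision A ν g)⁻¹ := by
  have hg' : (g : ℂ) ≠ 0 := by exact_mod_cast hg.ne'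
  have hν' : (ν : ℂ) ≠ 0 := by exact_mod_cast hν.ne'
  symm
  refine inv_eq_right_inv ?_
  -- This is `Q Q⁻¹ = 1` for `Q = obsCov A ν g`, solved for the signal part of `Q`.
  have hQ : (g : ℂ) • (A * Aᴴ * (obsCov A ν g)⁻¹) = 1 - (ν : ℂ) • (obsCov A ν g)⁻¹ := by
    have h1 := mul_nonsing_inv _ (posDef_obsCov (A := A) hν hg.le).isUnit_det
    conv at h1 => lhs; arg 1; rw [obsCov]
    rw [Matrix.add_mul, Matrix.smul_mul, Matrix.smul_mul, Matrix.one_mul] at h1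
    exact eq_sub_of_add_eq h1
  have h2 : (g : ℂ) • (Aᴴ * A * (Aᴴ * (obsCov A ν g)⁻¹ * A)) =
      Aᴴ * A - (ν : ℂ) • (Aᴴ * (obsCov A ν g)⁻¹ * A) := by
    calc (g : ℂ) • (Aᴴ * A * (Aᴴ * (obsCov A ν g)⁻¹ * A))
        = Aᴴ * ((g : ℂ) • (A * Aᴴ * (obsCov A ν g)⁻¹)) * A := by
          simp only [Matrix.mul_smul, Matrix.smul_mul, Matrix.mul_assoc]
      _ = _ := by
          rw [hQ, Matrix.mul_sub, Matrix.mul_one, Matrix.sub_mul, Matrix.mul_smul, Matrix.smul_mul]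
  have h3 : Aᴴ * A * (Aᴴ * (obsCov A ν g)⁻¹ * A) =
      (g : ℂ)⁻¹ • (Aᴴ * A - (ν : ℂ) • (Aᴴ * (obsCov A ν g)⁻¹ * A)) := by
    rw [← h2, smul_smul, inv_mul_cancel₀ hg', one_smul]
  rw [errCov, errPrecision, estCov, Matrix.mul_sub, Matrix.add_mul, Matrix.add_mul]
  simp only [Matrix.smul_mul, Matrix.mul_smul, Matrix.one_mul, Matrix.mul_one, h3, smul_sub,
    smul_smul]
  match_scalars <;> field_simp <;> ring

theorem posDef_errCov (hν : 0 < ν) (hg : 0 < g) : (errCov A ν g).PosDef := by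
  rw [errCov_eq_inv hν hg]
  exact (posDef_errPrecision hν hg).inv

omit [DecidableEq n] in
theorem obsCov_le {g' c : ℝ} (hν : 0 < ν) (hc : 1 ≤ c) (h : g ≤ c * g') :
    obsCov A ν g ≤ (c : ℂ) • obsCov A ν g' := by
  rw [obsCov, obsCov, smul_add, smul_smul, smul_smul]
  refine add_le_add ?_ ?_
  · exact_mod_cast coe_smul_le_coe_smul (posSemidef_self_mul_conjTranspose A).nonneg h
  · exact_mod_cast coe_smul_le_coe_smul PosSemidef.one.nonneg (le_mul_of_one_le_left hν.le hc)

omit [DecidableEq n] in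
-- The factor `c` comes from inverting `obsCov_le`, the factor `(g' / g) ^ 2` from exchanging the
-- prefactors of the two covariances.
theorem estCov_le {g' c : ℝ} (hν : 0 < ν) (hg : 0 < g) (hg' : 0 < g') (hc : 1 ≤ c)
    (h : g ≤ c * g') :
    estCov A ν g' ≤ ((c * (g' / g) ^ 2 : ℝ) : ℂ) • estCov A ν g := by
  have h1 := (posDef_obsCov hν hg.le).inv_le_smul_inv (posDef_obsCov hν hg'.le)
    (by positivity) (obsCov_le (A := A) hν hc h)
  have h2 := smul_le_smul_of_coe_nonneg (conjTranspose_conj_le_conj h1 A) (sq_nonneg g')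
  rw [estCov, estCov]
  convert h2 using 1
  · push_cast
    rfl
  · rw [Matrix.mul_smul, Matrix.smul_mul, smul_smul, smul_smul]
    congr 1
    have : (g : ℂ) ≠ 0 := by exact_mod_cast hg.ne'
    push_cast
    field_simp

theorem errCov_le {g' c : ℝ} (hν : 0 < ν) (hg : 0 < g) (hg' : 0 < g') (hc : 1 ≤ c)
    (h : g ≤ c * g') :
    errCov A ν g ≤ (c : ℂ) • errCov A ν g' := by
  rw [errCov_eq_inv hν hg, errCov_eq_inv hν hg']
  refine (posDef_errPrecision hν hg').inv_le_smul_inv (posDef_errPrecision hν hg)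
    (by positivity) ?_
  rw [errPrecision, errPrecision, smul_add, smul_smul, smul_smul]
  refine add_le_add ?_ ?_
  · have : g'⁻¹ ≤ c * g⁻¹ := by
      rw [inv_le_iff_one_le_mul₀ hg']
      rw [mul_assoc, mul_comm (g⁻¹), ← mul_assoc, ← div_eq_mul_inv, one_le_div hg]
      exact h
    exact_mod_cast coe_smul_le_coe_smul PosSemidef.one.nonneg this
  · exact_mod_cast coe_smul_le_coe_smul (posSemidef_conjTranspose_mul_self A).nonneg
      (le_mul_of_one_le_left (inv_pos.2 hν).le hc)

/-- The covariance, over the sub-frames, of the disturbance that an antenna sees because of the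
channel estimation error `C` and of the noise. -/
noncomputable def disturbCov (V : Matrix p n ℂ) (β ν : ℝ) (C : Matrix n n ℂ) : Matrix p p ℂ :=
  (β : ℂ) • (V * diagonal C.diag * Vᴴ) + (ν : ℂ) • 1

variable {V : Matrix p n ℂ} {β : ℝ}

theorem disturbCov_posDef (hβ : 0 < β) (hν : 0 < ν) {C : Matrix n n ℂ} (hC : C.PosSemidef) :
    (disturbCov V β ν C).PosDef :=
  PosDef.posSemidef_add
    (((PosSemidef.diagonal (fun _ => hC.diag_nonneg)).mul_mul_conjTranspose_same V).smul
      (by exact_mod_cast hβ.le : (0 : ℂ) ≤ β))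
    (PosDef.one.smul (by exact_mod_cast hν : (0 : ℂ) < ν))

omit [Fintype n] in
theorem diagonal_diag_le {C C' : Matrix n n ℂ} (h : C ≤ C') :
    diagonal C.diag ≤ diagonal C'.diag := by
  rw [Matrix.le_iff, diagonal_sub]
  exact PosSemidef.diagonal fun i => by simpa using PosSemidef.diag_nonneg h (i := i)

theorem disturbCov_le (hβ : 0 < β) (hν : 0 < ν) {C C' : Matrix n n ℂ} {c : ℝ} (hc : 1 ≤ c)
    (h : C ≤ (c : ℂ) • C') : disturbCov V β ν C ≤ (c : ℂ) • disturbCov V β ν C' := by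
  rw [disturbCov, disturbCov, smul_add]
  refine add_le_add ?_ ?_
  · have h1 := smul_le_smul_of_coe_nonneg (conj_le_conj (diagonal_diag_le h) V) hβ.le
    convert h1 using 1
    rw [diag_smul, diagonal_smul, Matrix.mul_smul, Matrix.smul_mul, smul_smul, smul_smul,
      mul_comm]
  · rw [smul_smul]
    exact_mod_cast coe_smul_le_coe_smul PosSemidef.one.nonneg (le_mul_of_one_le_left hν.le hc)

/-- The information about a row of the channel that the pilots of a user of path loss `g`
carry. -/
noncomputable def userInfo (A : Matrix m n ℂ) (V : Matrix p n ℂ) (β ν g : ℝ) : Matrix n n ℂ :=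
  (Vᴴ * (disturbCov V β ν (errCov A ν g))⁻¹ * V) ⊙ (estCov A ν g)ᵀ

theorem posSemidef_userInfo (hβ : 0 < β) (hν : 0 < ν) (hg : 0 < g) :
    (userInfo A V β ν g).PosSemidef :=
  PosSemidef.hadamard
    ((disturbCov_posDef hβ hν (posDef_errCov hν hg).posSemidef).inv.posSemidef
      |>.conjTranspose_mul_mul_same V)
    (posSemidef_estCov hν hg.le).transpose

/-- A change of path loss acts on both Hadamard factors: the inverse disturbance grows by at most
`c`, the estimate covariance by at most `c (g' / g)²`. The product of the two factors is `(c g' /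
g)²`. -/
theorem userInfo_le {g' K : ℝ} (hβ : 0 < β) (hν : 0 < ν) (hg : 0 < g) (hg' : 0 < g')
    (hK : 1 ≤ K) (h : g' ≤ K * g) :
    userInfo A V β ν g' ≤ ((K ^ 2 : ℝ) : ℂ) • userInfo A V β ν g := by
  -- The least constant admitted by both `errCov_le` and `estCov_le`. It makes `c * (g' / g)` equal
  -- to `max (g' / g) 1`, which is at most `K`.
  set c : ℝ := max 1 (g / g')
  have hc : 1 ≤ c := le_max_left _ _
  have hcg : g ≤ c * g' := (div_le_iff₀ hg').1 (le_max_right _ _)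
  have hcK : c * (g' / g) ≤ K := by
    rw [max_mul_of_nonneg _ _ (by positivity)]
    refine max_le ?_ ?_
    · rw [one_mul, div_le_iff₀ hg]; exact h
    · rw [div_mul_div_cancel₀ hg'.ne', div_self hg.ne']; exact hK
  have hD : (disturbCov V β ν (errCov A ν g')).PosDef :=
    disturbCov_posDef hβ hν (posDef_errCov hν hg').posSemidef
  have hD0 : (disturbCov V β ν (errCov A ν g)).PosDef :=
    disturbCov_posDef hβ hν (posDef_errCov hν hg).posSemidef
  have h1 := hD0.inv_le_smul_inv hD (by positivity)
    (disturbCov_le (V := V) hβ hν hc (errCov_le (A := A) hν hg hg' hc hcg))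
  have h2 := conjTranspose_conj_le_conj h1 V
  have h3 := transpose_le_transpose (estCov_le (A := A) hν hg hg' hc hcg)
  have h4 := hadamard_le_hadamard h2 h3
    (hD.inv.posSemidef.conjTranspose_mul_mul_same V).nonneg
    ((posSemidef_estCov hν hg.le).smul
      (by exact_mod_cast (by positivity : 0 ≤ c * (g' / g) ^ 2) :
        (0 : ℂ) ≤ ((c * (g' / g) ^ 2 : ℝ) : ℂ))).transpose.nonneg
  refine le_trans h4 ?_
  rw [transpose_smul, Matrix.mul_smul, Matrix.smul_mul, smul_hadamard, hadamard_smul, smul_smul]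
  change _ • userInfo A V β ν g ≤ _
  rw [← Complex.ofReal_mul]
  refine coe_smul_le_coe_smul (posSemidef_userInfo hβ hν hg).nonneg ?_
  calc c * (c * (g' / g) ^ 2) = (c * (g' / g)) ^ 2 := by ring
    _ ≤ K ^ 2 := by gcongr

end LMMSE

/-! ### The quadratic bound behind the Bayesian Cramér-Rao inequality -/

/-- The two sides differ by the trace of `β R Rᴴ + (W - W₀) D (W - W₀)ᴴ`, where `R = 1 - W U - β⁻¹
Z` and `W₀ = Z Uᴴ D⁻¹`. Equality holds for `Z` the inverse of the information matrix and `W = W₀`.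
Leaving `Z` free keeps the bound affine in the information matrix, so that it can be averaged over a
random `U`. -/
theorem linear_estimation_mse_bound {ι κ : Type*} [Fintype ι] [Fintype κ] [DecidableEq ι]
    [DecidableEq κ] {β : ℝ} (hβ : 0 < β) {D : Matrix κ κ ℂ} (hD : D.PosDef)
    (U : Matrix κ ι ℂ) (W : Matrix ι κ ℂ) {Z : Matrix ι ι ℂ} (hZ : Z.IsHermitian) :
    2 * Z.trace.re - (Z * ((1 / (β : ℂ)) • 1 + Uᴴ * D⁻¹ * U) * Z).trace.re ≤
      ((β : ℂ) • ((1 - W * U) * (1 - W * U)ᴴ) + W * D * Wᴴ).trace.re := by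
  have hβ' : (β : ℂ) ≠ 0 := by exact_mod_cast hβ.ne'
  have hDi : (D⁻¹)ᴴ = D⁻¹ := hD.isHermitian.inv
  have hZ' : Zᴴ = Z := hZ
  have h1 : D⁻¹ * D = 1 := nonsing_inv_mul _ hD.isUnit_det
  have h2 : D * D⁻¹ = 1 := mul_nonsing_inv _ hD.isUnit_det
  have h2' : ∀ Y : Matrix κ ι ℂ, D * (D⁻¹ * Y) = Y := fun Y => by
    rw [← Matrix.mul_assoc, h2, Matrix.one_mul]
  have h1' : ∀ Y : Matrix κ ι ℂ, D⁻¹ * (D * Y) = Y := fun Y => by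
    rw [← Matrix.mul_assoc, h1, Matrix.one_mul]
  have key : (β : ℂ) • ((1 - W * U) * (1 - W * U)ᴴ) + W * D * Wᴴ
      + Z * ((1 / (β : ℂ)) • 1 + Uᴴ * D⁻¹ * U) * Z - (Z + Z) =
      (β : ℂ) • ((1 - W * U - (β : ℂ)⁻¹ • Z) * (1 - W * U - (β : ℂ)⁻¹ • Z)ᴴ) +
        (W - Z * (Uᴴ * D⁻¹)) * D * (W - Z * (Uᴴ * D⁻¹))ᴴ := by
    simp only [conjTranspose_sub, conjTranspose_smul, conjTranspose_mul, conjTranspose_one, hZ',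
      hDi, conjTranspose_conjTranspose, Matrix.sub_mul, Matrix.mul_sub, Matrix.mul_add,
      Matrix.add_mul, Matrix.smul_mul, Matrix.mul_smul, Matrix.one_mul, Matrix.mul_one,
      Matrix.mul_assoc, h2', h1', smul_sub, smul_smul]
    have hs : star ((β : ℂ)⁻¹) = (β : ℂ)⁻¹ := by simp
    simp only [hs, one_div, mul_inv_cancel₀ hβ', mul_inv_cancel_left₀ hβ', one_smul]
    abel
  have hpsd : ((β : ℂ) • ((1 - W * U - (β : ℂ)⁻¹ • Z) * (1 - W * U - (β : ℂ)⁻¹ • Z)ᴴ) +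
        (W - Z * (Uᴴ * D⁻¹)) * D * (W - Z * (Uᴴ * D⁻¹))ᴴ).PosSemidef :=
    ((posSemidef_self_mul_conjTranspose _).smul (by exact_mod_cast hβ.le : (0 : ℂ) ≤ β)).add
      (hD.posSemidef.mul_mul_conjTranspose_same _)
  rw [← key] at hpsd
  have h := (Complex.le_def.1 hpsd.trace_nonneg).1
  rw [trace_sub, trace_add _ (Z * _ * Z), trace_add Z Z] at h
  simp only [Complex.zero_re, Complex.sub_re, Complex.add_re] at h ⊢
  rw [trace_add, Complex.add_re] at h ⊢
  linarith

/-! ### From second moments to mean square errors. -/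

section SecondMoments

variable {Ω : Type*} [MeasurableSpace Ω] {P : Measure Ω}

theorem lintegral_enorm_sq_eq {X : Ω → ℂ} (hX : MemLp X 2 P) :
    ∫⁻ ω, ‖X ω‖ₑ ^ 2 ∂P = ENNReal.ofReal (∫ ω, X ω * star (X ω) ∂P).re := by
  have h1 : ∀ ω, X ω * star (X ω) = ((‖X ω‖ ^ 2 : ℝ) : ℂ) := fun ω => by
    rw [Complex.star_def, Complex.mul_conj, Complex.normSq_eq_norm_sq]
  simp_rw [h1]
  rw [integral_complex_ofReal, Complex.ofReal_re,
    ofReal_integral_eq_lintegral_ofReal hX.norm.integrable_sq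
      (Filter.Eventually.of_forall fun _ => by positivity)]
  refine lintegral_congr fun ω => ?_
  rw [← ofReal_norm, ENNReal.ofReal_pow (norm_nonneg _)]

theorem re_integral_mul_star_self_nonneg (X : Ω → ℂ) :
    0 ≤ (∫ ω, X ω * star (X ω) ∂P).re := by
  have h1 : ∀ ω, X ω * star (X ω) = ((‖X ω‖ ^ 2 : ℝ) : ℂ) := fun ω => by
    rw [Complex.star_def, Complex.mul_conj, Complex.normSq_eq_norm_sq]
  simp_rw [h1]
  rw [integral_complex_ofReal, Complex.ofReal_re]
  exact integral_nonneg fun _ => by positivity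

theorem lintegral_sum_enorm_sq_eq {ι : Type*} [Fintype ι] {X : ι → Ω → ℂ}
    (hX : ∀ i, MemLp (X i) 2 P) :
    ∫⁻ ω, ∑ i, ‖X i ω‖ₑ ^ 2 ∂P =
      ENNReal.ofReal (∑ i, ∫ ω, X i ω * star (X i ω) ∂P).re := by
  rw [lintegral_finsetSum' _ fun i _ => by
    have := (hX i).aestronglyMeasurable
    fun_prop]
  simp_rw [lintegral_enorm_sq_eq (hX _)]
  rw [Complex.re_sum, ENNReal.ofReal_sum_of_nonneg fun i _ => re_integral_mul_star_self_nonneg _]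

/-- Only second moments enter, since `e` will contain products of Gaussians and is not Gaussian. The
error `(1 - W U) h - W e` has covariance `β (1 - W U) (1 - W U)ᴴ + W D Wᴴ`. -/
theorem linear_estimation_lintegral_bound {ι κ : Type*} [Fintype ι] [Fintype κ] [DecidableEq ι]
    [DecidableEq κ] {β : ℝ} (hβ : 0 < β) {D : Matrix κ κ ℂ} (hD : D.PosDef)
    {h : ι → Ω → ℂ} {e : κ → Ω → ℂ} (hh : ∀ i, MemLp (h i) 2 P) (he : ∀ i, MemLp (e i) 2 P)
    (hhh : ∀ i j, ∫ ω, h i ω * star (h j ω) ∂P = if i = j then (β : ℂ) else 0)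
    (hhe : ∀ i j, ∫ ω, h i ω * star (e j ω) ∂P = 0)
    (hee : ∀ i j, ∫ ω, e i ω * star (e j ω) ∂P = D i j)
    (U : Matrix κ ι ℂ) (W : Matrix ι κ ℂ) {Z : Matrix ι ι ℂ} (hZ : Z.IsHermitian) :
    ENNReal.ofReal (2 * Z.trace.re - (Z * ((1 / (β : ℂ)) • 1 + Uᴴ * D⁻¹ * U) * Z).trace.re) ≤
      ∫⁻ ω, ∑ p, ‖h p ω - (W *ᵥ (fun q => (U *ᵥ (fun i => h i ω)) q + e q ω)) p‖ₑ ^ 2 ∂P := by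
  set X : ι → Ω → ℂ := fun p ω =>
    ∑ s : ι ⊕ κ, Sum.elim ((1 - W * U : Matrix ι ι ℂ) p) (fun j => -W p j) s * Sum.elim h e s ω with hXdef
  have hXeq : ∀ p ω, h p ω - (W *ᵥ (fun q => (U *ᵥ (fun i => h i ω)) q + e q ω)) p = X p ω := by
    intro p ω
    have h1 : (fun q => (U *ᵥ (fun i => h i ω)) q + e q ω) =
      U *ᵥ (fun i => h i ω) + fun q => e q ω := rfl
    have h2 : ∑ i, (1 - W * U : Matrix ι ι ℂ) p i * h i ω = ((1 - W * U) *ᵥ (fun i => h i ω)) p := rfl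
    have h3 : ∑ j, -W p j * e j ω = -(W *ᵥ (fun j => e j ω)) p := by
      simp [mulVec, dotProduct]
    simp only [hXdef, Fintype.sum_sum_type, Sum.elim_inl, Sum.elim_inr]
    rw [h1, mulVec_add, mulVec_mulVec, h2, h3, sub_mulVec, one_mulVec]
    simp only [Pi.add_apply, Pi.sub_apply]
    ring
  have hq : ∀ s, MemLp (Sum.elim h e s) 2 P := by rintro (i | j) <;> simp [hh, he]
  have hX : ∀ p, MemLp (X p) 2 P := fun p =>
    memLp_finsetSum _ fun s _ => (hq s).const_mul _
  have heh : ∀ i j, ∫ ω, e j ω * star (h i ω) ∂P = 0 := fun i j => by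
    have h1 : ∀ ω, e j ω * star (h i ω) = star (h i ω * star (e j ω)) := fun ω => by
      simp [mul_comm]
    simp_rw [h1]
    have h2 : ∫ ω, star (h i ω * star (e j ω)) ∂P = star (∫ ω, h i ω * star (e j ω) ∂P) :=
      integral_conj
    rw [h2, hhe, star_zero]
  simp_rw [hXeq]
  rw [lintegral_sum_enorm_sq_eq hX]
  refine ENNReal.ofReal_le_ofReal
    ((linear_estimation_mse_bound hβ hD U W hZ).trans (le_of_eq ?_))
  congr 1
  rw [trace]
  refine Finset.sum_congr rfl fun p _ => ?_
  rw [IsCircularGaussianSpace.integral_sum_mul_star_sum hq hq]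
  simp only [Fintype.sum_sum_type, Sum.elim_inl, Sum.elim_inr, hhh, hhe, hee, heh, mul_zero,
    Finset.sum_const_zero, add_zero, zero_add]
  simp only [diag_apply, Matrix.add_apply, Matrix.smul_apply, mul_apply, conjTranspose_apply, smul_eq_mul,
    mul_ite, mul_zero, Finset.sum_ite_eq, Finset.mem_univ, if_true]
  congr 1
  · rw [Finset.mul_sum]
    exact Finset.sum_congr rfl fun i _ => by ring
  · simp_rw [Finset.sum_mul]
    rw [Finset.sum_comm]
    exact Finset.sum_congr rfl fun i _ => Finset.sum_congr rfl fun j _ => by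
      rw [star_neg]; ring

end SecondMoments

/-! ### Covariance calculus for the channels, estimates and errors. -/

namespace IsCircularGaussianSpace

variable {Ω : Type*} [MeasurableSpace Ω] {P : Measure Ω} {S : Submodule ℂ (Ω → ℂ)}

/-- The covariance `E[X conj Y]`, as a sesquilinear form on a space of circular Gaussians. -/
noncomputable def cov (h : IsCircularGaussianSpace S P) : S →ₗ[ℂ] S →ₗ⋆[ℂ] ℂ :=
  LinearMap.mk₂'ₛₗ (RingHom.id ℂ) (starRingEnd ℂ)
    (fun X Y => ∫ ω, (X : Ω → ℂ) ω * star ((Y : Ω → ℂ) ω) ∂P)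
    (fun X X' Y => by
      rw [← integral_add (integrable_mul_star (h.memLp_two X.2) (h.memLp_two Y.2))
        (integrable_mul_star (h.memLp_two X'.2) (h.memLp_two Y.2))]
      simp [add_mul])
    (fun c X Y => by
      rw [RingHom.id_apply, smul_eq_mul, ← integral_const_mul]
      simp [mul_assoc])
    (fun X Y Y' => by
      rw [← integral_add (integrable_mul_star (h.memLp_two X.2) (h.memLp_two Y.2))
        (integrable_mul_star (h.memLp_two X.2) (h.memLp_two Y'.2))]
      simp [mul_add])
    (fun c X Y => by
      rw [smul_eq_mul, ← integral_const_mul]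
      simp [mul_left_comm])

theorem cov_apply (h : IsCircularGaussianSpace S P) (X Y : S) :
    h.cov X Y = ∫ ω, (X : Ω → ℂ) ω * star ((Y : Ω → ℂ) ω) ∂P := rfl

theorem cov_swap (h : IsCircularGaussianSpace S P) (X Y : S) : h.cov Y X = star (h.cov X Y) := by
  rw [cov_apply, cov_apply]
  refine Eq.trans (integral_congr_ae (Filter.Eventually.of_forall fun ω => ?_)) integral_conj
  simp [mul_comm]

theorem cov_swap_eq_zero (h : IsCircularGaussianSpace S P) {X Y : S} (hXY : h.cov X Y = 0) :
    h.cov Y X = 0 := by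
  rw [cov_swap, hXY, star_zero]

end IsCircularGaussianSpace

section HybridModel

variable {Ω : Type*} [MeasurableSpace Ω] {P : Measure Ω} {S : Submodule ℂ (Ω → ℂ)}
  {m n k p b : Type} [Fintype n]
  [DecidableEq m] [DecidableEq n] [DecidableEq k] [DecidableEq p] [DecidableEq b]

/-- The channels and the projected noises of a hybrid reflecting and sensing metasurface, as white
jointly Gaussian families. -/
structure HybridChannels (hS : IsCircularGaussianSpace S P) (m n k p b : Type)
    [DecidableEq m] [DecidableEq n] [DecidableEq k] [DecidableEq p] [DecidableEq b]
    (β ν : ℝ) (g : k → ℝ) where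
  /-- channel from the metasurface to the base station -/
  H : m → n → S
  /-- channel from the users to the metasurface -/
  G : n → k → S
  /-- projected noise of the metasurface -/
  zr : p → k → S
  /-- projected noise of the base station -/
  zt : b → k → m → S
  cov_H : ∀ i j i' j', hS.cov (H i j) (H i' j') = if i = i' ∧ j = j' then (β : ℂ) else 0
  cov_G : ∀ i j i' j', hS.cov (G i j) (G i' j') = if i = i' ∧ j = j' then (g j : ℂ) else 0
  cov_zr : ∀ i j i' j', hS.cov (zr i j) (zr i' j') = if i = i' ∧ j = j' then (ν : ℂ) else 0
  cov_zt : ∀ i j l i' j' l', hS.cov (zt i j l) (zt i' j' l') =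
    if i = i' ∧ j = j' ∧ l = l' then (ν : ℂ) else 0
  cov_H_G : ∀ i j i' j', hS.cov (H i j) (G i' j') = 0
  cov_H_zr : ∀ i j i' j', hS.cov (H i j) (zr i' j') = 0
  cov_H_zt : ∀ i j i' j' l', hS.cov (H i j) (zt i' j' l') = 0
  cov_G_zr : ∀ i j i' j', hS.cov (G i j) (zr i' j') = 0
  cov_G_zt : ∀ i j i' j' l', hS.cov (G i j) (zt i' j' l') = 0
  cov_zr_zt : ∀ i j i' j' l', hS.cov (zr i j) (zt i' j' l') = 0

namespace HybridChannels

variable {hS : IsCircularGaussianSpace S P} {β ν : ℝ} {g : k → ℝ}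

/-- The projected observation of the metasurface. -/
noncomputable def obs (c : HybridChannels hS m n k p b β ν g) (A : Matrix p n ℂ) (i : p) (j : k) :
    S :=
  ∑ l, A i l • c.G l j + c.zr i j

variable [Fintype p]

/-- The linear MMSE estimate of the channel of the users. -/
noncomputable def est (c : HybridChannels hS m n k p b β ν g) (A : Matrix p n ℂ) (l : n) (j : k) :
    S :=
  ∑ i, lmmseWeight A ν (g j) l i • c.obs A i j

/-- The error of the linear MMSE estimate of the channel of the users. -/
noncomputable def err (c : HybridChannels hS m n k p b β ν g) (A : Matrix p n ℂ) (l : n) (j : k) :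
    S :=
  c.G l j - c.est A l j

variable (c : HybridChannels hS m n k p b β ν g) (A : Matrix p n ℂ)

omit [Fintype p] in
theorem cov_obs_G (i : p) (j : k) (l : n) (j' : k) :
    hS.cov (c.obs A i j) (c.G l j') = if j = j' then (g j : ℂ) * A i l else 0 := by
  have h1 := hS.cov_swap_eq_zero (c.cov_G_zr l j' i j)
  simp only [obs, map_add, map_sum, map_smul, LinearMap.add_apply, LinearMap.sum_apply,
    LinearMap.smul_apply, c.cov_G, h1, smul_eq_mul]
  split_ifs with hj
  · simp [hj, mul_comm]
  · simp [hj]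

omit [Fintype p] in
theorem cov_obs_obs (i : p) (j : k) (i' : p) (j' : k) :
    hS.cov (c.obs A i j) (c.obs A i' j') = if j = j' then obsCov A ν (g j) i i' else 0 := by
  have h1 : hS.cov (c.obs A i j) (c.zr i' j') = if i = i' ∧ j = j' then (ν : ℂ) else 0 := by
    simp only [obs, map_add, map_sum, map_smul, LinearMap.add_apply, LinearMap.sum_apply,
      LinearMap.smul_apply, c.cov_G_zr, c.cov_zr, smul_zero, Finset.sum_const_zero, zero_add]
  conv_lhs => rw [obs.eq_1 c A i' j']
  simp only [map_add, map_sum, map_smulₛₗ, c.cov_obs_G, h1, smul_eq_mul]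
  by_cases hj : j = j'
  · subst hj
    by_cases hi : i = i'
    · subst hi
      simp [obsCov, mul_apply, Finset.mul_sum, mul_comm, mul_left_comm, mul_assoc]
    · simp [obsCov, mul_apply, Finset.mul_sum, mul_left_comm, mul_comm, mul_assoc, hi]
  · simp [hj]

/-- The adjoint of the normal equations `lmmseWeight_mul_obsCov`. -/
theorem cov_obs_est (hν : 0 < ν) (hg : ∀ j, 0 < g j) (i : p) (j : k) (l : n) (j' : k) :
    hS.cov (c.obs A i j) (c.est A l j') = if j = j' then (g j : ℂ) * A i l else 0 := by
  simp only [est, map_sum, map_smulₛₗ, cov_obs_obs, smul_eq_mul]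
  split_ifs with hj
  · subst hj
    have h1 := congrArg conjTranspose (lmmseWeight_mul_obsCov (A := A) hν (hg j).le)
    have hQ : (obsCov A ν (g j))ᴴ = obsCov A ν (g j) := (posDef_obsCov hν (hg j).le).isHermitian
    rw [conjTranspose_mul, hQ, conjTranspose_smul, conjTranspose_conjTranspose] at h1
    have h2 := congrFun (congrFun h1 i) l
    simp only [mul_apply, conjTranspose_apply, Matrix.smul_apply, smul_eq_mul] at h2
    simpa [mul_comm] using h2
  · simp

/-- The orthogonality principle; in a circular Gaussian space it becomes independence of the error
from the observation. -/
theorem cov_obs_err (hν : 0 < ν) (hg : ∀ j, 0 < g j) (i : p) (j : k) (l : n) (j' : k) :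
    hS.cov (c.obs A i j) (c.err A l j') = 0 := by
  rw [err, map_sub, cov_obs_G, cov_obs_est c A hν hg, sub_self]

theorem cov_est_est (hν : 0 < ν) (hg : ∀ j, 0 < g j) (l l' : n) (j : k) :
    hS.cov (c.est A l j) (c.est A l' j) = estCov A ν (g j) l l' := by
  conv_lhs => rw [est.eq_1 c A l j]
  simp only [map_sum, map_smul, LinearMap.sum_apply, LinearMap.smul_apply,
    cov_obs_est c A hν hg, smul_eq_mul, if_true]
  rw [← lmmseWeight_mul A ν (g j), Matrix.smul_apply, mul_apply, smul_eq_mul, Finset.mul_sum]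
  exact Finset.sum_congr rfl fun i _ => by ring

/-- As the estimate is orthogonal to the errors, only `cov G err = cov G G - cov G est` remains. -/
theorem cov_err_err (hν : 0 < ν) (hg : ∀ j, 0 < g j) (l : n) (j : k) (l' : n) (j' : k) :
    hS.cov (c.err A l j) (c.err A l' j') = if j = j' then errCov A ν (g j) l l' else 0 := by
  have h1 : hS.cov (c.est A l j) (c.err A l' j') = 0 := by
    simp [est, LinearMap.sum_apply, cov_obs_err c A hν hg]
  have h2 : hS.cov (c.G l j) (c.est A l' j') = if j = j' then estCov A ν (g j) l l' else 0 := by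
    rw [hS.cov_swap]
    simp only [est, map_sum, map_smul, LinearMap.sum_apply, LinearMap.smul_apply, cov_obs_G,
      smul_eq_mul]
    by_cases hj : j' = j
    · subst hj
      have h3 := (posSemidef_estCov (A := A) hν (hg j').le).isHermitian.apply l l'
      rw [if_pos rfl, ← h3]
      congr 1
      rw [← lmmseWeight_mul A ν (g j'), Matrix.smul_apply, mul_apply, smul_eq_mul, Finset.mul_sum]
      exact Finset.sum_congr rfl fun i _ => by rw [if_pos rfl]; ring
    · simp [hj, Ne.symm hj]
  conv_lhs => rw [err.eq_1 c A l j]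
  rw [map_sub, LinearMap.sub_apply, h1, sub_zero, err, map_sub, h2, c.cov_G]
  by_cases hj : j = j'
  · subst hj
    simp [errCov, Matrix.one_apply]
  · simp [hj]

omit [Fintype p] in
theorem cov_H_obs (i : m) (l : n) (i' : p) (j : k) : hS.cov (c.H i l) (c.obs A i' j) = 0 := by
  simp [obs, c.cov_H_G, c.cov_H_zr]

theorem cov_H_err (i : m) (l l' : n) (j : k) : hS.cov (c.H i l) (c.err A l' j) = 0 := by
  simp [err, est, c.cov_H_G, cov_H_obs]

omit [Fintype p] in
theorem cov_obs_zt (i : p) (j : k) (i' : b) (j' : k) (l' : m) :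
    hS.cov (c.obs A i j) (c.zt i' j' l') = 0 := by
  simp [obs, LinearMap.sum_apply, c.cov_G_zt, c.cov_zr_zt]

end HybridChannels

end HybridModel

/-! ### Block diagonal matrices. -/

section BlockDiagonal

variable {m o : Type*} [Fintype m] [Fintype o] [DecidableEq o]

theorem Matrix.dotProduct_blockDiagonal_mulVec (M : o → Matrix m m ℂ) (x : m × o → ℂ) :
    star x ⬝ᵥ (blockDiagonal M *ᵥ x) =
      ∑ j, star (fun i => x (i, j)) ⬝ᵥ (M j *ᵥ fun i => x (i, j)) := by
  simp only [dotProduct, mulVec, Fintype.sum_prod_type, blockDiagonal_apply, ite_mul, zero_mul,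
    Finset.sum_ite_eq, Finset.mem_univ, if_true, Pi.star_apply]
  exact Finset.sum_comm

theorem Matrix.PosDef.blockDiagonal {M : o → Matrix m m ℂ} (hM : ∀ j, (M j).PosDef) :
    (Matrix.blockDiagonal M).PosDef := by
  refine .of_dotProduct_mulVec_pos (isHermitian_blockDiagonal_iff.2 fun j => (hM j).isHermitian)
    fun {x} hx => ?_
  rw [dotProduct_blockDiagonal_mulVec]
  obtain ⟨⟨i, j⟩, hij⟩ := Function.ne_iff.1 hx
  refine Finset.sum_pos' (fun j _ => (hM j).posSemidef.dotProduct_mulVec_nonneg _)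
    ⟨j, Finset.mem_univ _, (hM j).dotProduct_mulVec_pos fun h => hij (congrFun h i)⟩

theorem Matrix.inv_blockDiagonal [DecidableEq m] {M : o → Matrix m m ℂ}
    (hM : ∀ j, IsUnit (M j).det) :
    (Matrix.blockDiagonal M)⁻¹ = Matrix.blockDiagonal fun j => (M j)⁻¹ := by
  refine inv_eq_right_inv ?_
  rw [← blockDiagonal_mul]
  simp_rw [mul_nonsing_inv _ (hM _)]
  exact blockDiagonal_one

end BlockDiagonal

/-! ### Second moments of the disturbance at the base station. -/

section HybridModel

variable {Ω : Type*} [MeasurableSpace Ω] {P : Measure Ω} {S : Submodule ℂ (Ω → ℂ)}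
  {m n k p b : Type} [Fintype n] [Fintype p]
  [DecidableEq m] [DecidableEq n] [DecidableEq k] [DecidableEq p] [DecidableEq b]

namespace HybridChannels

variable {hS : IsCircularGaussianSpace S P} {β ν : ℝ} {g : k → ℝ}
  (c : HybridChannels hS m n k p b β ν g) (A : Matrix p n ℂ)

theorem aestronglyMeasurable (hS : IsCircularGaussianSpace S P) (X : S) :
    AEStronglyMeasurable (X : Ω → ℂ) P :=
  (hS.memLp_two X.2).aestronglyMeasurable

/-- The channel to the base station is independent of the estimation errors and of the noise. -/
theorem indepFun_H [Fintype m] [Fintype k] [Fintype b] :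
    IndepFun (fun ω (q : m × n) => (c.H q.1 q.2 : Ω → ℂ) ω)
      (fun ω (s : (n × k) ⊕ (b × k × m)) =>
        (Sum.elim (fun q => c.err A q.1 q.2) (fun q => c.zt q.1 q.2.1 q.2.2) s : Ω → ℂ) ω) P := by
  refine hS.indepFun (fun q => (c.H q.1 q.2).2) (by rintro (q | q) <;> exact Subtype.coe_prop _) ?_
  rintro q (r | r)
  · exact c.cov_H_err A q.1 q.2 r.1 r.2
  · exact c.cov_H_zt q.1 q.2 r.1 r.2.1 r.2.2

/-- Hölder with exponents `4, 4, 2`: Gaussians have fourth moments. -/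
theorem memLp_H_mul_err (i : m) (l : n) (l' : n) (j : k) :
    MemLp (fun ω => (c.H i l : Ω → ℂ) ω * (c.err A l' j : Ω → ℂ) ω) 2 P := by
  have : ENNReal.HolderTriple 4 4 2 := ⟨by
    rw [← two_mul, show (4 : ℝ≥0∞) = 2 * 2 by norm_num,
      ENNReal.mul_inv (by norm_num) (by norm_num), ← mul_assoc,
      ENNReal.mul_inv_cancel (by norm_num) (by norm_num), one_mul]⟩
  exact (hS.memLp (c.err A l' j).2 (p := 4) (by norm_num)).mul'
    (hS.memLp (c.H i l).2 (p := 4) (by norm_num))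

variable [Fintype m] [Fintype k] [Fintype b]

theorem integral_H_mul_star_H_mul_err (i : m) (l : n) (i' : m) (l' l'' : n) (j : k) :
    ∫ ω, (c.H i l : Ω → ℂ) ω * star ((c.H i' l' : Ω → ℂ) ω * (c.err A l'' j : Ω → ℂ) ω) ∂P = 0 := by
  have h := (c.indepFun_H A).comp (φ := fun x => x (i, l) * star (x (i', l')))
    (ψ := fun y => star (y (.inl (l'', j)))) (by fun_prop) (by fun_prop)
  have h2 := h.integral_mul_eq_mul_integral
    ((aestronglyMeasurable hS (c.H i l)).mul (aestronglyMeasurable hS (c.H i' l')).star)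
    (aestronglyMeasurable hS (c.err A l'' j)).star
  have h3 : ∫ ω, star ((c.err A l'' j : Ω → ℂ) ω) ∂P = 0 := by
    refine (integral_conj (f := (c.err A l'' j : Ω → ℂ))).trans ?_
    rw [hS.mean _ (c.err A l'' j).2, map_zero]
  refine Eq.trans (integral_congr_ae (Filter.Eventually.of_forall fun ω => ?_)) (h2.trans ?_)
  · simp [mul_assoc]
  · refine (congrArg _ h3).trans (mul_zero _)

theorem integral_H_mul_err_mul_star (i : m) (l l₁ : n) (j : k) (i' : m) (l' l₁' : n) (j' : k) :
    ∫ ω, ((c.H i l : Ω → ℂ) ω * (c.err A l₁ j : Ω → ℂ) ω) *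
      star ((c.H i' l' : Ω → ℂ) ω * (c.err A l₁' j' : Ω → ℂ) ω) ∂P =
      hS.cov (c.H i l) (c.H i' l') * hS.cov (c.err A l₁ j) (c.err A l₁' j') := by
  have h := (c.indepFun_H A).comp (φ := fun x => x (i, l) * star (x (i', l')))
    (ψ := fun y => y (.inl (l₁, j)) * star (y (.inl (l₁', j')))) (by fun_prop) (by fun_prop)
  have h2 := h.integral_mul_eq_mul_integral
    ((aestronglyMeasurable hS (c.H i l)).mul (aestronglyMeasurable hS (c.H i' l')).star)
    ((aestronglyMeasurable hS (c.err A l₁ j)).mul (aestronglyMeasurable hS (c.err A l₁' j')).star)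
  refine Eq.trans (integral_congr_ae (Filter.Eventually.of_forall fun ω => ?_)) h2
  simp [mul_assoc, mul_left_comm]

/-- The centred factor `H` is independent of the pair formed by the error and the noise, so it
splits off. -/
theorem integral_H_mul_err_mul_star_zt (i : m) (l l₁ : n) (j : k) (i' : b) (j' : k) (l' : m) :
    ∫ ω, ((c.H i l : Ω → ℂ) ω * (c.err A l₁ j : Ω → ℂ) ω) * star ((c.zt i' j' l' : Ω → ℂ) ω) ∂P =
      0 := by
  have hH : Measurable fun x : m × n → ℂ => x (i, l) := by fun_prop
  have h := (c.indepFun_H A).comp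
    (ψ := fun y => y (.inl (l₁, j)) * star (y (.inr (i', j', l')))) hH (by fun_prop)
  have h2 := h.integral_mul_eq_mul_integral (aestronglyMeasurable hS (c.H i l))
    ((aestronglyMeasurable hS (c.err A l₁ j)).mul (aestronglyMeasurable hS (c.zt i' j' l')).star)
  refine Eq.trans (integral_congr_ae (Filter.Eventually.of_forall fun ω => ?_)) (h2.trans ?_)
  · simp [mul_assoc]
  · refine (congrArg (· * _) (hS.mean _ (c.H i l).2)).trans (zero_mul _)

/-- The part of the observation of the base station that the estimate of the channel of the users
does not explain: the estimation error and the noise. -/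
noncomputable def disturb (V : Matrix b n ℂ) (q : b × (k × m)) (ω : Ω) : ℂ :=
  -- The noise is the summand over `Unit`, which makes the disturbance one linear combination, as
  -- `integral_sum_mul_star_sum` expects.
  ∑ s : n ⊕ Unit, Sum.elim (V q.1) (fun _ => 1) s *
    Sum.elim (fun l ω => (c.H q.2.2 l : Ω → ℂ) ω * (c.err A l q.2.1 : Ω → ℂ) ω)
      (fun _ => (c.zt q.1 q.2.1 q.2.2 : Ω → ℂ)) s ω

variable (V : Matrix b n ℂ)

omit [Fintype m] [Fintype k] [Fintype b] in
theorem disturb_eq (q : b × (k × m)) (ω : Ω) :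
    c.disturb A V q ω = ∑ l, V q.1 l * ((c.H q.2.2 l : Ω → ℂ) ω * (c.err A l q.2.1 : Ω → ℂ) ω) +
      (c.zt q.1 q.2.1 q.2.2 : Ω → ℂ) ω := by
  simp [disturb]

omit [Fintype m] [Fintype k] [Fintype b] in
theorem memLp_disturb_summand (q : b × (k × m)) (s : n ⊕ Unit) :
    MemLp (Sum.elim (fun l ω => (c.H q.2.2 l : Ω → ℂ) ω * (c.err A l q.2.1 : Ω → ℂ) ω)
      (fun _ => (c.zt q.1 q.2.1 q.2.2 : Ω → ℂ)) s) 2 P := by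
  rcases s with l | u
  · exact c.memLp_H_mul_err A q.2.2 l l q.2.1
  · exact hS.memLp_two (c.zt q.1 q.2.1 q.2.2).2

omit [Fintype m] [Fintype k] [Fintype b] in
theorem memLp_disturb (q : b × (k × m)) : MemLp (c.disturb A V q) 2 P :=
  memLp_finsetSum _ fun s _ => (c.memLp_disturb_summand A q s).const_mul _

theorem integral_H_mul_star_disturb (i : n × m) (q : b × (k × m)) :
    ∫ ω, (c.H i.2 i.1 : Ω → ℂ) ω * star (c.disturb A V q ω) ∂P = 0 := by
  have h := IsCircularGaussianSpace.integral_sum_mul_star_sum (P := P)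
    (X := fun _ : Unit => (c.H i.2 i.1 : Ω → ℂ)) (fun _ => hS.memLp_two (c.H i.2 i.1).2)
    (c.memLp_disturb_summand A q) (fun _ => 1) (Sum.elim (V q.1) fun _ => 1)
  simp only [Finset.univ_unique, Finset.sum_singleton, one_mul] at h
  refine h.trans (Finset.sum_eq_zero ?_)
  rintro (l | u) _
  · exact (congrArg _ (c.integral_H_mul_star_H_mul_err A _ _ _ _ _ _)).trans (mul_zero _)
  · exact (congrArg _ (c.cov_H_zt _ _ _ _ _)).trans (mul_zero _)

/-- Distinct entries of `H` are uncorrelated, so only the diagonal of the error covariance survives,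
and distinct antennas decouple. Distinct users decouple because their errors are uncorrelated. -/
theorem integral_disturb_mul_star_disturb (hν : 0 < ν) (hg : ∀ j, 0 < g j) (q q' : b × (k × m)) :
    ∫ ω, c.disturb A V q ω * star (c.disturb A V q' ω) ∂P =
      blockDiagonal (fun j : k × m => disturbCov V β ν (errCov A ν (g j.1))) q q' := by
  have hzt : ∀ l, ∫ ω, (c.zt q.1 q.2.1 q.2.2 : Ω → ℂ) ω *
      star ((c.H q'.2.2 l : Ω → ℂ) ω * (c.err A l q'.2.1 : Ω → ℂ) ω) ∂P = 0 := fun l => by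
    have h1 := congrArg star
      (c.integral_H_mul_err_mul_star_zt A q'.2.2 l l q'.2.1 q.1 q.2.1 q.2.2)
    rw [star_zero] at h1
    rw [← h1]
    refine Eq.trans (integral_congr_ae (Filter.Eventually.of_forall fun ω => ?_)) integral_conj
    simp [mul_comm]
  have hz := c.cov_zt q.1 q.2.1 q.2.2 q'.1 q'.2.1 q'.2.2
  rw [hS.cov_apply] at hz
  have h := IsCircularGaussianSpace.integral_sum_mul_star_sum (P := P)
    (c.memLp_disturb_summand A q) (c.memLp_disturb_summand A q')
    (Sum.elim (V q.1) fun _ => 1) (Sum.elim (V q'.1) fun _ => 1)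
  refine h.trans ?_
  simp only [Fintype.sum_sum_type, Sum.elim_inl, Sum.elim_inr, c.integral_H_mul_err_mul_star,
    c.integral_H_mul_err_mul_star_zt, hzt, hz, c.cov_H, c.cov_err_err A hν hg, mul_zero,
    Finset.sum_const_zero, add_zero, zero_add, Finset.univ_unique, Finset.sum_singleton, star_one,
    one_mul, blockDiagonal_apply]
  obtain ⟨i, j, l⟩ := q
  obtain ⟨i', j', l'⟩ := q'
  by_cases hl : l = l'
  · by_cases hj : j = j'
    · subst hl hj
      simp [disturbCov, mul_apply, Matrix.one_apply, diagonal_apply, Finset.mul_sum]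
      refine Finset.sum_congr rfl fun r _ => ?_
      ring
    · simp [hj]
  · simp [hl]

end HybridChannels

end HybridModel

/-! ### Freezing an independent variable and averaging the bound. -/

section Integration

variable {Ω : Type*} [MeasurableSpace Ω] {P : Measure Ω}

theorem lintegral_of_indepFun [IsFiniteMeasure P] {α γ : Type*} [MeasurableSpace α]
    [MeasurableSpace γ] {X : Ω → α} {Y : Ω → γ} (hX : AEMeasurable X P) (hY : AEMeasurable Y P)
    (hXY : IndepFun X Y P) {F : α × γ → ℝ≥0∞} (hF : Measurable F) :
    ∫⁻ ω, F (X ω, Y ω) ∂P = ∫⁻ ω', ∫⁻ ω, F (X ω', Y ω) ∂P ∂P := by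
  rw [← lintegral_map' (f := F) (g := fun ω => (X ω, Y ω)) hF.aemeasurable (hX.prodMk hY),
    (indepFun_iff_map_prod_eq_prod_map_map hX hY).1 hXY, lintegral_prod _ hF.aemeasurable,
    lintegral_map' (hF.lintegral_prod_right').aemeasurable hX]
  refine lintegral_congr fun ω' => ?_
  exact lintegral_map' (hF.comp measurable_prodMk_left).aemeasurable hY

/-- Truncating the negative part of `f` can only increase the integral. -/
theorem ofReal_integral_le_lintegral_ofReal {f : Ω → ℝ} (hf : Integrable f P) :
    ENNReal.ofReal (∫ ω, f ω ∂P) ≤ ∫⁻ ω, ENNReal.ofReal (f ω) ∂P := by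
  rw [integral_eq_lintegral_pos_part_sub_lintegral_neg_part hf]
  exact (ENNReal.ofReal_le_ofReal (sub_le_self _ ENNReal.toReal_nonneg)).trans
    ENNReal.ofReal_toReal_le

theorem integral_trace_mul_mul {ι : Type*} [Fintype ι] (Z : Matrix ι ι ℂ)
    {J : Ω → Matrix ι ι ℂ} {J' : Matrix ι ι ℂ} (hJ : ∀ i j, Integrable (fun ω => J ω i j) P)
    (hJ' : ∀ i j, ∫ ω, J ω i j ∂P = J' i j) :
    Integrable (fun ω => (Z * J ω * Z).trace) P ∧
      ∫ ω, (Z * J ω * Z).trace ∂P = (Z * J' * Z).trace := by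
  simp only [trace, diag_apply, mul_apply, Finset.sum_mul]
  have h1 : ∀ i j l, Integrable (fun ω => Z i l * J ω l j * Z j i) P := fun i j l =>
    ((hJ l j).const_mul _).mul_const _
  refine ⟨integrable_finsetSum _ fun i _ => integrable_finsetSum _ fun j _ =>
    integrable_finsetSum _ fun l _ => h1 i j l, ?_⟩
  rw [integral_finsetSum _ fun i _ => integrable_finsetSum _ fun j _ =>
    integrable_finsetSum _ fun l _ => h1 i j l]
  refine Finset.sum_congr rfl fun i _ => ?_
  rw [integral_finsetSum _ fun j _ => integrable_finsetSum _ fun l _ => h1 i j l]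
  refine Finset.sum_congr rfl fun j _ => ?_
  rw [integral_finsetSum _ fun l _ => h1 i j l]
  refine Finset.sum_congr rfl fun l _ => ?_
  rw [integral_mul_const, integral_const_mul, hJ']

end Integration

/-! ### The mean square error bound for a hybrid surface. -/

section HybridModel

variable {Ω : Type*} [MeasurableSpace Ω] {P : Measure Ω} {S : Submodule ℂ (Ω → ℂ)}
  {m n k p b : Type} [Fintype n]
  [DecidableEq m] [DecidableEq n] [DecidableEq k] [DecidableEq p] [DecidableEq b]

/-- The matrix that maps `vec H` to the noiseless observation of the base station when `E` is the
channel of the users. -/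
def reflectMatrix (V : Matrix b n ℂ) (E : n → k → ℂ) : Matrix (b × (k × m)) (n × m) ℂ :=
  Matrix.of fun q i => if q.2.2 = i.2 then V q.1 i.1 * E i.1 q.2.1 else 0

omit [DecidableEq n] [DecidableEq k] [DecidableEq b] in
theorem reflectMatrix_mulVec [Fintype m] (V : Matrix b n ℂ) (E : n → k → ℂ) (h : n × m → ℂ)
    (q : b × (k × m)) :
    (reflectMatrix V E *ᵥ h) q = ∑ r, V q.1 r * (h (r, q.2.2) * E r q.2.1) := by
  simp only [mulVec, dotProduct, reflectMatrix, of_apply, Fintype.sum_prod_type, ite_mul, zero_mul,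
    Finset.sum_ite_eq, Finset.mem_univ, if_true]
  exact Finset.sum_congr rfl fun r _ => by ring

omit [DecidableEq n] [Fintype n] [DecidableEq b] in
-- The antenna index is a spectator: every antenna sees the same `V`, `E` and `D`, whence the
-- Kronecker factor `1` later on.
theorem conj_reflectMatrix_apply [Fintype m] [Fintype k] [Fintype b] (V : Matrix b n ℂ)
    (E : n → k → ℂ) (D : k → Matrix b b ℂ) (i i' : n × m) :
    ((reflectMatrix (m := m) V E)ᴴ * blockDiagonal (fun j : k × m => D j.1) *
      reflectMatrix (m := m) V E) i i' =
      if i.2 = i'.2 then ∑ j, ∑ t', ∑ t, star (V t i.1) * D j t t' * V t' i'.1 *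
        (E i'.1 j * star (E i.1 j)) else 0 := by
  simp only [mul_apply, conjTranspose_apply, reflectMatrix, of_apply, blockDiagonal_apply,
    Fintype.sum_prod_type, apply_ite star, star_zero, ite_mul, mul_ite, zero_mul, mul_zero,
    Finset.sum_ite_eq', Finset.mem_univ, if_true]
  by_cases hi : i.2 = i'.2
  · simp only [if_pos hi, if_pos hi.symm]
    rw [Finset.sum_comm]
    refine Finset.sum_congr rfl fun j _ => Finset.sum_congr rfl fun t' _ => ?_
    rw [Finset.sum_mul]
    refine Finset.sum_congr rfl fun t _ => ?_
    simp only [star_mul']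
    ring
  · simp [hi, Ne.symm hi]

namespace HybridChannels

variable {hS : IsCircularGaussianSpace S P} {β ν : ℝ} {g : k → ℝ}
  (c : HybridChannels hS m n k p b β ν g) (A : Matrix p n ℂ)

/-- The projected observation of the base station. -/
noncomputable def reflected (V : Matrix b n ℂ) (q : b × (k × m)) (ω : Ω) : ℂ :=
  ∑ r, V q.1 r * ((c.H q.2.2 r : Ω → ℂ) ω * (c.G r q.2.1 : Ω → ℂ) ω) +
    (c.zt q.1 q.2.1 q.2.2 : Ω → ℂ) ω

variable [Fintype p]

theorem reflected_eq [Fintype m] (V : Matrix b n ℂ) (q : b × (k × m)) (ω : Ω) :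
    c.reflected V q ω =
      ((reflectMatrix V fun r j => (c.est A r j : Ω → ℂ) ω) *ᵥ
        fun i : n × m => (c.H i.2 i.1 : Ω → ℂ) ω) q + c.disturb A V q ω := by
  rw [reflectMatrix_mulVec, disturb_eq, reflected, ← add_assoc, ← Finset.sum_add_distrib]
  congr 1
  refine Finset.sum_congr rfl fun r _ => ?_
  have h : (c.err A r q.2.1 : Ω → ℂ) ω =
    (c.G r q.2.1 : Ω → ℂ) ω - (c.est A r q.2.1 : Ω → ℂ) ω := rfl
  rw [h]
  ring

theorem est_apply (r : n) (j : k) (ω : Ω) :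
    (c.est A r j : Ω → ℂ) ω = ∑ i, lmmseWeight A ν (g j) r i * (c.obs A i j : Ω → ℂ) ω := by
  simp [est]

variable [Fintype m] [Fintype k] [Fintype b]

/-- The observation of the metasurface is independent of the channel to the base station, of the
estimation errors and of the noise of the base station. -/
theorem indepFun_obs (hν : 0 < ν) (hg : ∀ j, 0 < g j) :
    IndepFun (fun ω (q : p × k) => (c.obs A q.1 q.2 : Ω → ℂ) ω)
      (fun ω (s : (m × n) ⊕ ((n × k) ⊕ (b × k × m))) =>
        (Sum.elim (fun q => (c.H q.1 q.2 : Ω → ℂ)) (Sum.elim (fun q => (c.err A q.1 q.2 : Ω → ℂ))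
          (fun q => (c.zt q.1 q.2.1 q.2.2 : Ω → ℂ))) s) ω) P := by
  refine hS.indepFun (fun q => (c.obs A q.1 q.2).2)
    (by rintro (q | q | q) <;> exact Subtype.coe_prop _) ?_
  rintro q (r | r | r)
  · exact hS.cov_swap_eq_zero (c.cov_H_obs A r.1 r.2 q.1 q.2)
  · exact c.cov_obs_err A hν hg q.1 q.2 r.1 r.2
  · exact c.cov_obs_zt A q.1 q.2 r.1 r.2.1 r.2.2

/-- The mean of the information matrix of the base station. -/
theorem integral_information (hν : 0 < ν) (hg : ∀ j, 0 < g j) (V : Matrix b n ℂ)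
    (i i' : n × m) [IsProbabilityMeasure P] :
    let J : Ω → Matrix (n × m) (n × m) ℂ := fun ω =>
      (reflectMatrix (m := m) V fun r j => (c.est A r j : Ω → ℂ) ω)ᴴ *
        blockDiagonal (fun j : k × m => (disturbCov V β ν (errCov A ν (g j.1)))⁻¹) *
        reflectMatrix (m := m) V fun r j => (c.est A r j : Ω → ℂ) ω
    Integrable (fun ω => ((1 / (β : ℂ)) • (1 : Matrix (n × m) (n × m) ℂ) + J ω) i i') P ∧
      ∫ ω, ((1 / (β : ℂ)) • (1 : Matrix (n × m) (n × m) ℂ) + J ω) i i' ∂P =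
        ((1 / (β : ℂ)) • (1 : Matrix (n × m) (n × m) ℂ) +
          (∑ j, userInfo A V β ν (g j)) ⊗ₖ (1 : Matrix m m ℂ)) i i' := by
  intro J
  have h2 : ∀ j, Integrable (fun ω => (c.est A i'.1 j : Ω → ℂ) ω * star ((c.est A i.1 j : Ω → ℂ) ω))
      P := fun j =>
    IsCircularGaussianSpace.integrable_mul_star (hS.memLp_two (c.est A i'.1 j).2)
      (hS.memLp_two (c.est A i.1 j).2)
  have key : Integrable (fun ω => J ω i i') P ∧
      ∫ ω, J ω i i' ∂P = ((∑ j, userInfo A V β ν (g j)) ⊗ₖ (1 : Matrix m m ℂ)) i i' := by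
    simp only [J, conj_reflectMatrix_apply V _ fun j => (disturbCov V β ν (errCov A ν (g j)))⁻¹,
      kroneckerMap_apply, Matrix.one_apply, mul_ite, mul_one, mul_zero]
    split_ifs with hi
    · have h3 : ∀ j t' t, Integrable (fun ω => star (V t i.1) *
          (disturbCov V β ν (errCov A ν (g j)))⁻¹ t t' * V t' i'.1 *
          ((c.est A i'.1 j : Ω → ℂ) ω * star ((c.est A i.1 j : Ω → ℂ) ω))) P := fun j t' t =>
        (h2 j).const_mul _
      refine ⟨integrable_finsetSum _ fun j _ => integrable_finsetSum _ fun t' _ =>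
        integrable_finsetSum _ fun t _ => h3 j t' t, ?_⟩
      rw [integral_finsetSum _ fun j _ => integrable_finsetSum _ fun t' _ =>
        integrable_finsetSum _ fun t _ => h3 j t' t, Matrix.sum_apply]
      refine Finset.sum_congr rfl fun j _ => ?_
      rw [integral_finsetSum _ fun t' _ => integrable_finsetSum _ fun t _ => h3 j t' t, userInfo,
        hadamard_apply, transpose_apply, mul_apply, Finset.sum_mul]
      refine Finset.sum_congr rfl fun t' _ => ?_
      rw [integral_finsetSum _ fun t _ => h3 j t' t, mul_apply, Finset.sum_mul, Finset.sum_mul]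
      refine Finset.sum_congr rfl fun t _ => ?_
      rw [integral_const_mul]
      exact congrArg _ (c.cov_est_est A hν hg i'.1 i.1 j)
    · simp
  simp only [Matrix.add_apply]
  refine ⟨(integrable_const _).add key.1, ?_⟩
  rw [integral_add (integrable_const _) key.1, key.2]
  simp

/-- The weights may depend on the whole sensed observation. Independence allows it to be frozen; the
quadratic bound holds for each frozen value with the same `Z`, and its average involves only the
mean information. -/
theorem mse_lower_bound [IsProbabilityMeasure P] (hβ : 0 < β) (hν : 0 < ν) (hg : ∀ j, 0 < g j)
    (V : Matrix b n ℂ) {W : (p × k → ℂ) → Matrix (n × m) (b × (k × m)) ℂ}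
    (hW : ∀ i q, Measurable fun y => W y i q) {Z : Matrix (n × m) (n × m) ℂ}
    (hZ : Z.IsHermitian) :
    ENNReal.ofReal (2 * Z.trace.re - (Z * ((1 / (β : ℂ)) • 1 +
      (∑ j, userInfo A V β ν (g j)) ⊗ₖ (1 : Matrix m m ℂ)) * Z).trace.re) ≤
      ∫⁻ ω, ∑ i, ‖(c.H i.2 i.1 : Ω → ℂ) ω -
        (W (fun q => (c.obs A q.1 q.2 : Ω → ℂ) ω) *ᵥ fun q => c.reflected V q ω) i‖ₑ ^ 2 ∂P := by
  set D := blockDiagonal (fun j : k × m => disturbCov V β ν (errCov A ν (g j.1)))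
  have hD' : ∀ j : k × m, (disturbCov V β ν (errCov A ν (g j.1))).PosDef := fun j =>
    disturbCov_posDef hβ hν (posDef_errCov hν (hg j.1)).posSemidef
  have hD : D.PosDef := PosDef.blockDiagonal hD'
  set E : (p × k → ℂ) → n → k → ℂ := fun y r j => ∑ i, lmmseWeight A ν (g j) r i * y (i, j)
  -- The squared error as a function of the sensed observation and of the variables independent of
  -- it, with `E` recomputing the estimates from the former.
  set F : (p × k → ℂ) × ((m × n) ⊕ ((n × k) ⊕ (b × k × m)) → ℂ) → ℝ≥0∞ := fun x =>
    ∑ i : n × m, ‖x.2 (.inl (i.2, i.1)) - (W x.1 *ᵥ fun q =>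
      (∑ r, V q.1 r * (x.2 (.inl (q.2.2, r)) * E x.1 r q.2.1)) +
        (∑ r, V q.1 r * (x.2 (.inl (q.2.2, r)) * x.2 (.inr (.inl (r, q.2.1)))) +
          x.2 (.inr (.inr (q.1, q.2.1, q.2.2))))) i‖ₑ ^ 2
  have hF : Measurable F := by
    refine Finset.measurable_sum _ fun i _ => ?_
    simp only [mulVec, dotProduct, E]
    have hW' : ∀ q, Measurable fun x : (p × k → ℂ) × ((m × n) ⊕ ((n × k) ⊕ (b × k × m)) → ℂ) =>
        W x.1 i q := fun q => (hW i q).comp measurable_fst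
    fun_prop
  set Y : Ω → p × k → ℂ := fun ω q => (c.obs A q.1 q.2 : Ω → ℂ) ω
  set R : Ω → (m × n) ⊕ ((n × k) ⊕ (b × k × m)) → ℂ := fun ω s =>
    (Sum.elim (fun q => (c.H q.1 q.2 : Ω → ℂ)) (Sum.elim (fun q => (c.err A q.1 q.2 : Ω → ℂ))
          (fun q => (c.zt q.1 q.2.1 q.2.2 : Ω → ℂ))) s) ω
  have hY : AEMeasurable Y P :=
    (hS.joint (p × k) (fun q => (c.obs A q.1 q.2 : Ω → ℂ)) fun _ => Subtype.coe_prop _).aemeasurable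
  have hR : AEMeasurable R P :=
    (hS.joint ((m × n) ⊕ ((n × k) ⊕ (b × k × m))) (Sum.elim (fun q => (c.H q.1 q.2 : Ω → ℂ))
      (Sum.elim (fun q => (c.err A q.1 q.2 : Ω → ℂ))
        (fun q => (c.zt q.1 q.2.1 q.2.2 : Ω → ℂ))))
      (by rintro (q | q | q) <;> exact Subtype.coe_prop _)).aemeasurable
  have hest : ∀ ω, E (Y ω) = fun r j => (c.est A r j : Ω → ℂ) ω := fun ω => by
    funext r j
    rw [est_apply]
  have hlhs : ∀ ω, ∑ i : n × m, ‖(c.H i.2 i.1 : Ω → ℂ) ω -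
      (W (Y ω) *ᵥ fun q => c.reflected V q ω) i‖ₑ ^ 2 = F (Y ω, R ω) := fun ω => by
    simp only [c.reflected_eq A, disturb_eq, reflectMatrix_mulVec, ← hest]
    rfl
  -- For a frozen `y` both the weights and the estimates `E y` are constants.
  have hinner : ∀ y, ENNReal.ofReal (2 * Z.trace.re - (Z * ((1 / (β : ℂ)) • 1 +
      (reflectMatrix (m := m) V (E y))ᴴ * D⁻¹ * reflectMatrix (m := m) V (E y)) * Z).trace.re) ≤
      ∫⁻ ω, F (y, R ω) ∂P := fun y => by
    refine (linear_estimation_lintegral_bound (P := P) hβ hD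
      (h := fun i => (c.H i.2 i.1 : Ω → ℂ)) (e := c.disturb A V)
      (fun i => hS.memLp_two (c.H i.2 i.1).2) (c.memLp_disturb A V) (fun i j => ?_)
      (c.integral_H_mul_star_disturb A V) (c.integral_disturb_mul_star_disturb A V hν hg)
      (reflectMatrix V (E y)) (W y) hZ).trans (le_of_eq ?_)
    · refine (c.cov_H _ _ _ _).trans ?_
      simp only [Prod.ext_iff, and_comm]
    · refine lintegral_congr fun ω => ?_
      simp only [disturb_eq, reflectMatrix_mulVec]
      rfl
  refine le_trans ?_ (lintegral_congr hlhs).ge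
  rw [lintegral_of_indepFun hY hR (c.indepFun_obs A hν hg) hF]
  refine le_trans ?_ (lintegral_mono fun ω' => hinner (Y ω'))
  have hint := fun i i' => c.integral_information A hν hg V i i'
  have hDinv : D⁻¹ = blockDiagonal (fun j : k × m => (disturbCov V β ν (errCov A ν (g j.1)))⁻¹) :=
    inv_blockDiagonal fun j => (hD' j).isUnit_det
  simp only [hest, hDinv]
  obtain ⟨hI, hE⟩ := integral_trace_mul_mul Z (fun i j => (hint i j).1) (fun i j => (hint i j).2)
  refine le_trans (le_of_eq ?_)
    (ofReal_integral_le_lintegral_ofReal ((integrable_const _).sub hI.re))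
  refine congrArg _ (Eq.symm ((integral_sub (integrable_const _) hI.re).trans ?_))
  rw [integral_re hI, hE]
  simp

end HybridChannels

end HybridModel

/-! ### The matrices of the theorem in terms of the mean path loss. -/

namespace HRISSystem

variable {M N K Nr B T : ℕ} (s : HRISSystem M N K Nr B T)

/-- The variance `(TΓ)⁻¹` of the projected noise. -/
noncomputable def projNoise : ℝ := ((T : ℝ) * s.Γ)⁻¹

/-- The mean path loss of the users. -/
noncomputable def meanGain : ℝ := (∑ k, s.g k) / K

/-- The reflection coefficients; row `b` is the diagonal of `Ψ(b)`. -/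
noncomputable def reflCoeff : Matrix (Fin B) (Fin N) ℂ :=
  Matrix.of fun b l => (s.ρ b l : ℂ) * Complex.exp (Complex.I * (s.ψ b l : ℂ))

theorem Psi_eq (b : Fin B) : s.Psi b = diagonal (s.reflCoeff b) := rfl

theorem Γ_pos : 0 < s.Γ := div_pos s.Pt_pos s.σ2_pos

theorem projNoise_pos (hT : 0 < T) : 0 < s.projNoise :=
  inv_pos.2 (mul_pos (by exact_mod_cast hT) s.Γ_pos)

theorem meanGain_pos (hK : 0 < K) : 0 < s.meanGain :=
  div_pos (Finset.sum_pos (fun k _ => s.g_pos k) ⟨⟨0, hK⟩, Finset.mem_univ _⟩)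
    (by exact_mod_cast hK)

theorem sum_g_eq (hK : 0 < K) : (∑ k, (s.g k : ℂ)) = (K : ℂ) * (s.meanGain : ℂ) := by
  have : (K : ℂ) ≠ 0 := by exact_mod_cast hK.ne'
  rw [meanGain]
  push_cast
  field_simp

theorem g_le (hK : 0 < K) (k : Fin K) : s.g k ≤ K * s.meanGain := by
  have hK' : (K : ℝ) ≠ 0 := by exact_mod_cast hK.ne'
  rw [meanGain, mul_div_cancel₀ _ hK']
  exact Finset.single_le_sum (fun k _ => (s.g_pos k).le) (Finset.mem_univ k)

/-- Since `R_G = K ḡ I`, the precision of the theorem is `K⁻¹` times that of a user of path loss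
`ḡ`. -/
theorem RGerr_eq (hK : 0 < K) (hT : 0 < T) :
    s.RGerr = (K : ℂ) • errCov s.Arc s.projNoise s.meanGain := by
  have hK' : (K : ℂ) ≠ 0 := by exact_mod_cast hK.ne'
  have hg : (s.meanGain : ℂ) ≠ 0 := by exact_mod_cast (s.meanGain_pos hK).ne'
  rw [errCov_eq_inv (s.projNoise_pos hT) (s.meanGain_pos hK), RGerr, RG, s.sum_g_eq hK,
    inv_smul_of_ne_zero (by simp) (mul_ne_zero hK' hg), inv_one]
  have h1 : ((K : ℂ) * (s.meanGain : ℂ))⁻¹ • (1 : Matrix (Fin N) (Fin N) ℂ) +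
      ((T : ℂ) * (s.Γ : ℂ) * (K : ℂ)⁻¹) • (s.Arcᴴ * s.Arc) =
      (K : ℂ)⁻¹ • errPrecision s.Arc s.projNoise s.meanGain := by
    rw [errPrecision, smul_add, smul_smul, smul_smul, projNoise]
    push_cast
    rw [inv_inv, mul_inv, mul_comm ((T : ℂ) * _)]
  rw [h1, inv_smul_of_ne_zero
    (posDef_errPrecision (s.projNoise_pos hT) (s.meanGain_pos hK)).isUnit_det (inv_ne_zero hK'),
    inv_inv]

/-- Each `R_G` contributes a factor `K`, the inverse a factor `K⁻¹`. -/
theorem Sig_eq (hK : 0 < K) (hT : 0 < T) :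
    s.Sig = (K : ℂ) • estCov s.Arc s.projNoise s.meanGain := by
  have hK' : (K : ℂ) ≠ 0 := by exact_mod_cast hK.ne'
  have h1 : s.Arc * s.RG * s.Arcᴴ + ((K : ℂ) * ((T : ℂ) * (s.Γ : ℂ))⁻¹) • 1 =
      (K : ℂ) • obsCov s.Arc s.projNoise s.meanGain := by
    rw [RG, s.sum_g_eq hK, obsCov, smul_add, smul_smul, smul_smul, projNoise]
    push_cast
    rw [Matrix.mul_smul, Matrix.mul_one, Matrix.smul_mul]
  rw [Sig, h1, inv_smul_of_ne_zero
    (posDef_obsCov (s.projNoise_pos hT) (s.meanGain_pos hK).le).isUnit_det hK', RG,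
    s.sum_g_eq hK, estCov, conjTranspose_smul, conjTranspose_one]
  simp only [Matrix.smul_mul, Matrix.mul_smul, Matrix.one_mul, Matrix.mul_one, smul_smul]
  congr 1
  simp only [star_mul', Complex.star_def, Complex.conj_natCast, Complex.conj_ofReal]
  field_simp

/-- The common diagonal block of `D`. -/
noncomputable def meanDisturbCov : Matrix (Fin B) (Fin B) ℂ :=
  disturbCov s.reflCoeff s.β s.projNoise (errCov s.Arc s.projNoise s.meanGain)

theorem meanDisturbCov_posDef (hK : 0 < K) (hT : 0 < T) : s.meanDisturbCov.PosDef :=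
  disturbCov_posDef s.β_pos (s.projNoise_pos hT)
    (posDef_errCov (s.projNoise_pos hT) (s.meanGain_pos hK)).posSemidef

theorem D_eq (hK : 0 < K) (hT : 0 < T) :
    s.D = blockDiagonal fun _ : Fin K => s.meanDisturbCov := by
  have hK' : (K : ℂ) ≠ 0 := by exact_mod_cast hK.ne'
  ext ⟨i, k⟩ ⟨j, k'⟩
  have htr : ((s.Psi j)ᴴ * s.Psi i * s.RGerr).trace =
      (K : ℂ) * (s.reflCoeff * diagonal (errCov s.Arc s.projNoise s.meanGain).diag *
        s.reflCoeffᴴ) i j := by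
    rw [s.RGerr_eq hK hT, Psi_eq, Psi_eq, diagonal_conjTranspose, diagonal_mul_diagonal,
      Matrix.mul_smul, trace_smul, smul_eq_mul]
    congr 1
    simp only [trace, diag_apply, diagonal_mul, mul_diagonal, mul_apply (N := s.reflCoeffᴴ),
      conjTranspose_apply, Pi.star_apply]
    exact Finset.sum_congr rfl fun l _ => by ring
  simp only [D, of_apply, htr, blockDiagonal_apply, meanDisturbCov, disturbCov, Matrix.add_apply,
    Matrix.smul_apply, smul_eq_mul, projNoise]
  by_cases hk : k = k'
  · subst hk
    by_cases hij : i = j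
    · subst hij
      simp
      field_simp
    · simp [hij]
      field_simp
  · by_cases hij : i = j
    · simp [hk, hij]
    · simp [hk, hij]

theorem D_posDef (hK : 0 < K) (hT : 0 < T) : s.D.PosDef := by
  rw [s.D_eq hK hT]
  exact PosDef.blockDiagonal fun _ => s.meanDisturbCov_posDef hK hT

/-- The information about a row of the channel that a user of mean path loss carries. -/
noncomputable def meanInfo : Matrix (Fin N) (Fin N) ℂ :=
  userInfo s.Arc s.reflCoeff s.β s.projNoise s.meanGain

/-- The three factors `K` are the explicit one, the trace of a `K × K` scalar block of `D⁻¹`, and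
the one of `Sig_eq`. -/
theorem infoMatrix_eq (hK : 0 < K) (hT : 0 < T) :
    s.infoMatrix = (1 / (s.β : ℂ)) • 1 +
      (((K : ℂ) ^ 3) • s.meanInfo) ⊗ₖ (1 : Matrix (Fin M) (Fin M) ℂ) := by
  rw [infoMatrix]
  congr 2
  have hblock : ∀ i j, (block (s.D⁻¹)ᵀ i j).trace = (K : ℂ) * s.meanDisturbCov⁻¹ j i := by
    intro i j
    rw [s.D_eq hK hT, inv_blockDiagonal fun _ => (s.meanDisturbCov_posDef hK hT).isUnit_det]
    simp [block, trace, blockDiagonal_apply]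
  ext l l'
  simp only [hblock, transpose_apply, Matrix.smul_apply, smul_eq_mul, Matrix.sum_apply,
    Psi_eq, diagonal_conjTranspose, mul_diagonal, diagonal_mul, Pi.star_apply, s.Sig_eq hK hT,
    meanInfo, userInfo, hadamard_apply]
  rw [mul_apply]
  simp only [mul_apply, conjTranspose_apply, Finset.sum_mul, Finset.mul_sum]
  rw [Finset.sum_comm]
  refine Finset.sum_congr rfl fun i _ => Finset.sum_congr rfl fun j _ => ?_
  rw [meanDisturbCov]
  ring

open scoped MatrixOrder in
-- Each of the `K` users has path loss at most `K ḡ`, so it costs a factor `K²`.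
theorem sum_userInfo_le (hK : 0 < K) (hT : 0 < T) :
    ∑ k, userInfo s.Arc s.reflCoeff s.β s.projNoise (s.g k) ≤ ((K : ℂ) ^ 3) • s.meanInfo := by
  have h1 : ∀ k ∈ Finset.univ, userInfo s.Arc s.reflCoeff s.β s.projNoise (s.g k) ≤
      (((K : ℝ) ^ 2 : ℝ) : ℂ) • s.meanInfo := fun k _ =>
    userInfo_le s.β_pos (s.projNoise_pos hT) (s.meanGain_pos hK) (s.g_pos k)
      (by exact_mod_cast hK) (s.g_le hK k)
  refine (Finset.sum_le_card_nsmul _ _ _ h1).trans (le_of_eq ?_)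
  rw [Finset.card_univ, Fintype.card_fin, ← Nat.cast_smul_eq_nsmul ℂ, smul_smul]
  congr 1
  push_cast
  ring

theorem infoMatrix_posDef (hK : 0 < K) (hT : 0 < T) : s.infoMatrix.PosDef := by
  rw [s.infoMatrix_eq hK hT]
  refine PosDef.add_posSemidef (PosDef.one.smul ?_) (PosSemidef.kronecker (PosSemidef.smul
    (posSemidef_userInfo s.β_pos (s.projNoise_pos hT) (s.meanGain_pos hK)) ?_) PosSemidef.one)
  · rw [one_div]
    exact_mod_cast inv_pos.2 s.β_pos
  · positivity

open scoped MatrixOrder in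
theorem trueInfo_le (hK : 0 < K) (hT : 0 < T) :
    (1 / (s.β : ℂ)) • 1 + (∑ k, userInfo s.Arc s.reflCoeff s.β s.projNoise (s.g k)) ⊗ₖ
      (1 : Matrix (Fin M) (Fin M) ℂ) ≤ s.infoMatrix := by
  have hsub : ∀ X Y : Matrix (Fin N) (Fin N) ℂ,
      (X - Y) ⊗ₖ (1 : Matrix (Fin M) (Fin M) ℂ) = X ⊗ₖ 1 - Y ⊗ₖ 1 := fun X Y => by
    ext
    simp [sub_mul]
  rw [s.infoMatrix_eq hK hT, Matrix.le_iff, add_sub_add_left_eq_sub, ← hsub]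
  exact PosSemidef.kronecker (s.sum_userInfo_le hK hT) PosSemidef.one

/-- The quadratic bound at `Z = X⁻¹`: as the mean information is at most `X`, the subtracted trace
is at most `tr (X⁻¹ X X⁻¹) = tr X⁻¹`. -/
theorem re_trace_inv_infoMatrix_le (hK : 0 < K) (hT : 0 < T) :
    (s.infoMatrix⁻¹).trace.re ≤ 2 * (s.infoMatrix⁻¹).trace.re -
      (s.infoMatrix⁻¹ * ((1 / (s.β : ℂ)) • 1 +
        (∑ k, userInfo s.Arc s.reflCoeff s.β s.projNoise (s.g k)) ⊗ₖ
          (1 : Matrix (Fin M) (Fin M) ℂ)) * s.infoMatrix⁻¹).trace.re := by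
  have hX := s.infoMatrix_posDef hK hT
  have hZ : (s.infoMatrix⁻¹)ᴴ = s.infoMatrix⁻¹ := hX.isHermitian.inv
  have h1 := re_trace_le_re_trace (conj_le_conj (s.trueInfo_le hK hT) s.infoMatrix⁻¹)
  rw [hZ, nonsing_inv_mul _ hX.isUnit_det, Matrix.one_mul] at h1
  linarith

theorem im_trace_inv_infoMatrix (hK : 0 < K) (hT : 0 < T) :
    (s.infoMatrix⁻¹).trace.im = 0 :=
  ((Complex.le_def.1 (s.infoMatrix_posDef hK hT).inv.posSemidef.trace_nonneg).2).symm

theorem project_pilots {r : Type*} (hT : 0 < T) (X : Matrix r (Fin K) ℂ)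
    (z : Matrix r (Fin T) ℂ) :
    HRISRandom.project s (X * ((Real.sqrt s.Pt : ℂ) • s.S) + z) = X + HRISRandom.project s z := by
  have hP : (Real.sqrt s.Pt : ℂ) ≠ 0 := by exact_mod_cast (Real.sqrt_pos.2 s.Pt_pos).ne'
  have hT' : (T : ℂ) ≠ 0 := by exact_mod_cast hT.ne'
  rw [HRISRandom.project, HRISRandom.project, Matrix.add_mul, smul_add, Matrix.mul_smul,
    Matrix.smul_mul, Matrix.mul_assoc, s.pilots, Matrix.mul_smul, Matrix.mul_one, smul_smul,
    smul_smul]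
  congr 1
  rw [show ((T : ℂ) * (Real.sqrt s.Pt : ℂ))⁻¹ * (Real.sqrt s.Pt : ℂ) * (T : ℂ) = 1 by
    field_simp, one_smul]

end HRISSystem

/-! ### The Rayleigh system as an instance of the hybrid model. -/

namespace HRISRandom

variable {Ω : Type*} [MeasurableSpace Ω] {P : Measure Ω} {M N K Nr B T : ℕ}
  (x : HRISRandom Ω M N K Nr B T) (s : HRISSystem M N K Nr B T)

/-- The indices of the scalar random variables of the system. -/
abbrev EntryIndex (M N K Nr B T : ℕ) : Type :=
  ((Fin M × Fin N) ⊕ (Fin N × Fin K)) ⊕ ((Fin B × Fin Nr × Fin T) ⊕ (Fin B × Fin M × Fin T))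

/-- The variances of the scalar random variables of the system. -/
def entryVar : EntryIndex M N K Nr B T → ℝ
  | .inl (.inl _) => s.β
  | .inl (.inr q) => s.g q.2
  | .inr _ => s.σ2

theorem entryVar_nonneg (i : EntryIndex M N K Nr B T) : 0 ≤ entryVar s i := by
  rcases i with (q | q) | q
  · exact s.β_pos.le
  · exact (s.g_pos q.2).le
  · exact s.σ2_pos.le

variable {x s}

theorem IsRayleigh.hasLaw (hx : x.IsRayleigh s P) (i) :
    HasLaw (x.entries i) (complexGaussian (entryVar s i)) P := by
  rcases i with (q | q) | (q | q)
  · exact hx.law_H q.1 q.2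
  · exact hx.law_G q.1 q.2
  · exact hx.law_zRC q.1 q.2.1 q.2.2
  · exact hx.law_zBS q.1 q.2.1 q.2.2

theorem IsRayleigh.isCircularGaussianSpace (hx : x.IsRayleigh s P) :
    IsCircularGaussianSpace (Submodule.span ℂ (Set.range x.entries)) P :=
  isCircularGaussianSpace_span (entryVar_nonneg s) hx.hasLaw hx.indep

variable (x s)

/-- The scalar random variables of the system, as elements of the space that they span. -/
def entry (i : EntryIndex M N K Nr B T) : Submodule.span ℂ (Set.range x.entries) :=
  ⟨x.entries i, Submodule.subset_span ⟨i, rfl⟩⟩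

/-- The projection on the pilot of user `k` of the received samples of indices `e`. -/
noncomputable def projEntry (e : Fin T → EntryIndex M N K Nr B T) (k : Fin K) :
    Submodule.span ℂ (Set.range x.entries) :=
  ∑ t, (((T : ℂ) * (Real.sqrt s.Pt : ℂ))⁻¹ * star (s.S k t)) • x.entry (e t)

variable {x s}

theorem cov_entry (hx : x.IsRayleigh s P) (i j) :
    hx.isCircularGaussianSpace.cov (x.entry i) (x.entry j) =
      if i = j then (entryVar s i : ℂ) else 0 :=
  integral_mul_star_of_iIndepFun (entryVar_nonneg s) hx.hasLaw hx.indep i j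

theorem cov_entry_projEntry (hx : x.IsRayleigh s P) {i} {e} (h : ∀ t, i ≠ e t) (k : Fin K) :
    hx.isCircularGaussianSpace.cov (x.entry i) (x.projEntry s e k) = 0 := by
  simp [projEntry, cov_entry hx, h]

theorem cov_projEntry_eq_zero (hx : x.IsRayleigh s P) {e e'} (h : ∀ t t', e t ≠ e' t')
    (k k' : Fin K) :
    hx.isCircularGaussianSpace.cov (x.projEntry s e k) (x.projEntry s e' k') = 0 := by
  conv_lhs => rw [projEntry.eq_1 x s e]
  simp only [map_sum, map_smul, LinearMap.sum_apply, LinearMap.smul_apply,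
    cov_entry_projEntry hx (h _), smul_zero, Finset.sum_const_zero]

/-- Orthogonality of the pilots keeps the projected noise white, of variance `σ² T / (T² Pt) =
(TΓ)⁻¹`. -/
theorem cov_projEntry (hT : 0 < T) (hx : x.IsRayleigh s P) {e} (he : Function.Injective e)
    (hv : ∀ t, entryVar s (e t) = s.σ2) (k k' : Fin K) :
    hx.isCircularGaussianSpace.cov (x.projEntry s e k) (x.projEntry s e k') =
      if k = k' then (s.projNoise : ℂ) else 0 := by
  have hpil := congrFun (congrFun s.pilots k') k
  rw [mul_apply, Matrix.smul_apply, smul_eq_mul, Matrix.one_apply] at hpil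
  simp only [conjTranspose_apply] at hpil
  simp only [projEntry, map_sum, map_smul, map_smulₛₗ, LinearMap.sum_apply, LinearMap.smul_apply,
    cov_entry hx, he.eq_iff, hv, smul_eq_mul, mul_ite, mul_zero,
    Finset.sum_ite_eq', Finset.mem_univ, if_true]
  have hP : (Real.sqrt s.Pt : ℂ) ^ 2 = (s.Pt : ℂ) := by exact_mod_cast Real.sq_sqrt s.Pt_pos.le
  have hP0 : (s.Pt : ℂ) ≠ 0 := by exact_mod_cast s.Pt_pos.ne'
  have hP1 : (Real.sqrt s.Pt : ℂ) ≠ 0 := by exact_mod_cast (Real.sqrt_pos.2 s.Pt_pos).ne'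
  have hσ : (s.σ2 : ℂ) ≠ 0 := by exact_mod_cast s.σ2_pos.ne'
  have hT' : (T : ℂ) ≠ 0 := by exact_mod_cast hT.ne'
  calc _ = ((T : ℂ) * (Real.sqrt s.Pt : ℂ))⁻¹ ^ 2 * (s.σ2 : ℂ) *
        ∑ t, s.S k' t * star (s.S k t) := by
        rw [Finset.mul_sum]
        refine Finset.sum_congr rfl fun t _ => ?_
        simp
        ring
    _ = _ := by
        rw [hpil]
        by_cases hk : k = k'
        · rw [if_pos hk, if_pos hk.symm, HRISSystem.projNoise, HRISSystem.Γ]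
          push_cast
          rw [mul_inv, mul_pow, inv_pow, inv_pow, hP]
          field_simp
        · rw [if_neg hk, if_neg (Ne.symm hk), mul_zero, mul_zero]

/-- The channels and the projected noises of a Rayleigh system. -/
noncomputable def IsRayleigh.channels (hx : x.IsRayleigh s P) (hT : 0 < T) :
    HybridChannels hx.isCircularGaussianSpace (Fin M) (Fin N) (Fin K) (Fin B × Fin Nr) (Fin B)
      s.β s.projNoise s.g where
  H i j := x.entry (.inl (.inl (i, j)))
  G i j := x.entry (.inl (.inr (i, j)))
  zr i j := x.projEntry s (fun t => .inr (.inl (i.1, i.2, t))) j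
  zt i j l := x.projEntry s (fun t => .inr (.inr (i, l, t))) j
  cov_H i j i' j' := by simp [cov_entry hx, entryVar]
  cov_G i j i' j' := by simp [cov_entry hx, entryVar]
  cov_zr i j i' j' := by
    by_cases hi : i = i'
    · subst hi
      rw [cov_projEntry hT hx (fun t t' h => by simpa using h) fun t => rfl]
      simp
    · rw [cov_projEntry_eq_zero hx fun t t' h => hi (by
        simp only [Sum.inr.injEq, Sum.inl.injEq, Prod.mk.injEq] at h
        exact Prod.ext h.1 h.2.1)]
      simp [hi]
  cov_zt i j l i' j' l' := by
    by_cases hi : i = i' ∧ l = l'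
    · obtain ⟨rfl, rfl⟩ := hi
      rw [cov_projEntry hT hx (fun t t' h => by simpa using h) fun t => rfl]
      simp
    · rw [cov_projEntry_eq_zero hx fun t t' h => hi (by
        simp only [Sum.inr.injEq, Prod.mk.injEq] at h
        exact ⟨h.1, h.2.1⟩), if_neg fun h => hi ⟨h.1, h.2.2⟩]
  cov_H_G i j i' j' := by simp [cov_entry hx]
  cov_H_zr i j i' j' := cov_entry_projEntry hx (by simp) _
  cov_H_zt i j i' j' l' := cov_entry_projEntry hx (by simp) _
  cov_G_zr i j i' j' := cov_entry_projEntry hx (by simp) _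
  cov_G_zt i j i' j' l' := cov_entry_projEntry hx (by simp) _
  cov_zr_zt i j i' j' l' := cov_projEntry_eq_zero hx (by simp) _ _

omit [MeasurableSpace Ω] in
theorem projEntry_apply (e) (k : Fin K) (ω : Ω) :
    (x.projEntry s e k : Ω → ℂ) ω =
      ∑ t, ((T : ℂ) * (Real.sqrt s.Pt : ℂ))⁻¹ * (x.entries (e t) ω * star (s.S k t)) := by
  simp only [projEntry, entry, Submodule.coe_sum, Submodule.coe_smul, Finset.sum_apply,
    Pi.smul_apply, smul_eq_mul]
  exact Finset.sum_congr rfl fun t _ => by ring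

theorem project_apply {r : Type*} (z : Matrix r (Fin T) ℂ) (i : r) (k : Fin K) :
    project s z i k = ∑ t, ((T : ℂ) * (Real.sqrt s.Pt : ℂ))⁻¹ * (z i t * star (s.S k t)) := by
  rw [project, Matrix.smul_apply, mul_apply, smul_eq_mul, Finset.mul_sum]
  rfl

theorem obs_channels_apply (hx : x.IsRayleigh s P) (hT : 0 < T) (q : Fin B × Fin Nr) (k : Fin K)
    (ω : Ω) :
    ((hx.channels hT).obs s.Arc q k : Ω → ℂ) ω = project s (x.yRC s q.1 ω) q.2 k := by
  rw [yRC, s.project_pilots hT, Matrix.add_apply, project_apply, mul_apply]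
  simp only [HybridChannels.obs, IsRayleigh.channels, Submodule.coe_add, Submodule.coe_sum,
    Submodule.coe_smul, Pi.add_apply, Finset.sum_apply, Pi.smul_apply, projEntry_apply]
  rfl

theorem reflected_channels (hx : x.IsRayleigh s P) (hT : 0 < T) (q : Fin B × (Fin K × Fin M))
    (ω : Ω) :
    (hx.channels hT).reflected s.reflCoeff q ω = x.obsBS s ω q := by
  rw [obsBS, yBS, s.project_pilots hT, vec_add, Pi.add_apply, vec, vec, project_apply, mul_apply]
  simp only [HybridChannels.reflected, IsRayleigh.channels, projEntry_apply, s.Psi_eq,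
    mul_diagonal]
  congr 1
  exact Finset.sum_congr rfl fun r _ => by
    simp only [entry, entries]
    ring

theorem Ghat_eq (hx : x.IsRayleigh s P) (hT : 0 < T) (ω : Ω) :
    x.Ghat s ω = s.Mopt * Matrix.of fun q k =>
      ((hx.channels hT).obs s.Arc q k : Ω → ℂ) ω := by
  simp only [obs_channels_apply]
  rfl

theorem le_mseOf [IsProbabilityMeasure P] (hx : x.IsRayleigh s P) (hK : 0 < K) (hT : 0 < T)
    {W : Matrix (Fin N) (Fin K) ℂ → Matrix (Fin N × Fin M) (Fin B × (Fin K × Fin M)) ℂ}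
    (hW : IsWeight W) :
    ENNReal.ofReal (s.infoMatrix⁻¹).trace.re ≤ x.mseOf s P W := by
  refine (ENNReal.ofReal_le_ofReal (s.re_trace_inv_infoMatrix_le hK hT)).trans ?_
  refine ((hx.channels hT).mse_lower_bound s.Arc s.β_pos (s.projNoise_pos hT) s.g_pos s.reflCoeff
    -- A weight depending on `Ghat` depends on the sensed observation through `Mopt`, so it is one
    -- of the weights covered by `mse_lower_bound`.
    (W := fun y => W (s.Mopt * Matrix.of fun q k => y (q, k))) (fun i q => ?_)
    (s.infoMatrix_posDef hK hT).isHermitian.inv).trans (le_of_eq ?_)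
  · have hM : Measurable fun (y : (Fin B × Fin Nr) × Fin K → ℂ) (l : Fin N) (k : Fin K) =>
        (s.Mopt * Matrix.of fun q k => y (q, k)) l k := by
      simp only [mul_apply, of_apply]
      fun_prop
    exact (hW i q).comp hM
  · refine lintegral_congr fun ω => ?_
    rw [Ghat_eq hx hT]
    simp only [reflected_channels]
    rfl

/-- The zero estimator already has finite error, namely the second moment of `H`. -/
theorem mseH_ne_top (hx : x.IsRayleigh s P) : x.mseH s P ≠ ⊤ := by
  have h1 : x.mseH s P ≤ x.mseOf s P fun _ => 0 :=
    iInf₂_le (fun _ => 0) fun _ _ => measurable_const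
  refine ne_top_of_le_ne_top ?_ h1
  have h2 : x.mseOf s P (fun _ => 0) =
      ∫⁻ ω, ∑ i : Fin N × Fin M, ‖x.entries (.inl (.inl (i.2, i.1))) ω‖ₑ ^ 2 ∂P := by
    refine lintegral_congr fun ω => ?_
    simp [entries, vec]
  rw [h2, lintegral_sum_enorm_sq_eq
    (X := fun i : Fin N × Fin M => x.entries (.inl (.inl (i.2, i.1)))) fun i =>
    hx.isCircularGaussianSpace.memLp_two (x.entry (.inl (.inl (i.2, i.1)))).2]
  exact ENNReal.ofReal_ne_top

end HRISRandom

theorem theorem2 {Ω : Type*} [MeasurableSpace Ω] (P : Measure Ω) [IsProbabilityMeasure P]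
    {M N K Nr B T : ℕ} (hK : 0 < K) (hT : 0 < T)
    (s : HRISSystem M N K Nr B T) (x : HRISRandom Ω M N K Nr B T) (hx : x.IsRayleigh s P) :
    s.D.PosDef ∧ s.infoMatrix.PosDef ∧ x.mseH s P ≠ ⊤ ∧
      (s.infoMatrix⁻¹.trace).im = 0 ∧
      (s.infoMatrix⁻¹.trace).re ≤ (x.mseH s P).toReal :=
  ⟨s.D_posDef hK hT, s.infoMatrix_posDef hK hT, HRISRandom.mseH_ne_top hx,
    s.im_trace_inv_infoMatrix hK hT,
    (ENNReal.ofReal_le_iff_le_toReal (HRISRandom.mseH_ne_top hx)).1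
      (le_iInf₂ fun _ hW => HRISRandom.le_mseOf hx hK hT hW)⟩
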